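/- Let $y=(y_n)_{n\ge 1}$ be an aperiodic sequence, i.e. a bounded sequence of real numbers such that for all integers $t\ge 1$ and $l\ge 0$ $$\lim_{n\to\infty}\frac1n\sum_{i=1}^n y_{it+l}=0,$$ and let $N\ge 2$ be an integer. Then for every $\varepsilon>0$ there exists a subshift $\Sigma'$ over $N$ symbols (a closed subset of $\{0,\dots,N-1\}^{\mathbb N}$ invariant under the shift map $T$) such that 1. $(\Sigma',T)$ is strictly ergodic, i.e. minimal ($\Sigma'$ is nonempty and its only closed subsets $A$ with $T(A)\subseteq A$ are $\emptyset$ and $\Sigma'$) and uniquely ergodic (there is exactly one $T$-invariant Borel probability measure on $\Sigma'$); 2. the topological entropy of $(\Sigma',T)$ satisfies $|h(\Sigma')-\log N|<\varepsilon$; 3. $(\Sigma',T)$ is uniformly uncorrelated to $y$: for every continuous function $f:\Sigma'\to\mathbb R$, $$\lim_{n\to\infty}\ \sup_{x\in\Sigma'}\left|\frac1n\sum_{i=1}^n f(T^ix)\,y_i\right|=0.$$ -/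

import Mathlib

open MeasureTheory Filter Topology SymbolicDynamics.FullShift

/-- A real sequence `y₁, y₂, …` (the value `y 0` plays no role) is *aperiodic* if it is bounded and
has zero average along every infinite arithmetic progression. -/
def IsAperiodicSeq (y : ℕ → ℝ) : Prop :=
  (∃ C : ℝ, ∀ n : ℕ, 1 ≤ n → |y n| ≤ C) ∧
  ∀ t l : ℕ, 1 ≤ t →
    Tendsto (fun n : ℕ => (1 / (n : ℝ)) * ∑ i ∈ Finset.Icc 1 n, y (i * t + l)) atTop (𝓝 0)

/-- The system `(X, T)` is *uniformly uncorrelated* to `y`: for each continuous `f : X → ℝ` the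
averages `(1/n) ∑_{i=1}^n f(Tⁱ x) yᵢ` converge to `0` uniformly in `x`. -/
def UniformlyUncorrelated {X : Type*} [TopologicalSpace X] (T : X → X) (y : ℕ → ℝ) : Prop :=
  ∀ f : C(X, ℝ), TendstoUniformly
    (fun (n : ℕ) (x : X) => (1 / (n : ℝ)) * ∑ i ∈ Finset.Icc 1 n, f (T^[i] x) * y i)
    (fun _ => 0) atTop

/-- The system `(X, T)` is *minimal*: `X` is nonempty and has no closed forward-invariant subsets
other than `∅` and `X`. -/
def IsMinimalSystem {X : Type*} [TopologicalSpace X] (T : X → X) : Prop :=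
  Nonempty X ∧ ∀ A : Set X, IsClosed A → Set.MapsTo T A A → A = ∅ ∨ A = Set.univ

/-- The system `(X, T)` is *uniquely ergodic*: it has exactly one invariant Borel probability
measure. -/
def IsUniquelyErgodic {X : Type*} [TopologicalSpace X] [MeasurableSpace X] [BorelSpace X]
    (T : X → X) : Prop :=
  ∃! μ : Measure X, IsProbabilityMeasure μ ∧ MeasurePreserving T μ μ

/-- *Strictly ergodic* means minimal and uniquely ergodic. -/
def IsStrictlyErgodic {X : Type*} [TopologicalSpace X] [MeasurableSpace X] [BorelSpace X]
    (T : X → X) : Prop :=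
  IsMinimalSystem T ∧ IsUniquelyErgodic T

/-- The shift map `(x₀, x₁, …) ↦ (x₁, x₂, …)` restricted to a one-sided subshift. -/
def subshiftMap {A : Type*} [TopologicalSpace A] (S : Subshift A ℕ) : S.carrier → S.carrier :=
  (S.mapsTo 1).restrict (shift 1) S.carrier S.carrier

/-- The topological entropy of a one-sided subshift over a finite (discrete) alphabet: the
Bowen–Dinaburg entropy of the shift map on the subshift. The uniformity is the one induced from the
product of the discrete uniformities; the subshift being compact, it is the only uniformity
compatible with its topology. -/
noncomputable def subshiftEntropy {N : ℕ} (S : Subshift (Fin N) ℕ) : EReal :=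
  letI : UniformSpace (Fin N) := ⊥
  Dynamics.coverEntropy (subshiftMap S) Set.univ

/-! The subshift is built from a hierarchy of blocks chosen by a counting argument. With `p = period
P k`, a block of level `k + 1` is a concatenation of `q = p ^ 4` blocks of level `k` that is
balanced: for the first few words of an enumeration of all words, for both weights (the constant
`1`, and `y` shifted by one and divided by a bound), and for polynomially many starting positions of
the weight, the weighted count of the word inside the sub-blocks differs from its expectation by at
most `q`, a proportion `1 / p` of the length. By the Chernoff bound `card_le_of_lt_abs_sum` each
condition fails for a proportion at most `2 exp (-p² / 4)` of all concatenations. This beats the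
polynomial number of conditions and even a factor `N ^ p`, so at most a proportion `defect` is
discarded (`card_unbalanced_le`).

Little is discarded, so the entropy loss is at most `2 / P` (`exp_le_card_blocks`) and the uniform
law on blocks barely changes from level to level: positional frequencies at high levels are close in
mean to the periodic continuation of those at level `k` (`sum_abs_freq_sub_le`). Hence along any
point of the subshift, and for either weight, the word counts follow a sequence of period `p` up to
a small proportion, uniformly in the point (`exists_phase`). Weight `1` gives uniform Birkhoff
averages, hence unique ergodicity. For the weight `y` the periodic prediction contributes nothing in
the limit, because `y` has zero mean along arithmetic progressions; this gives the absence of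
correlation.

For minimality, a word seen in one block has a positive frequency there, and the later losses sum to
at most half of it (`le_sum_freq`), so balance forces the word to occur in every point
(`exists_startsWith`). The same fact makes every block appear at the start of some point, which
turns the count of blocks into a lower bound for the entropy. -/

section Probability

/-! ### Chernoff bounds as counting statements. -/

/-- One-sided Chernoff bound for a sum of independent centred variables, each uniformly distributed
on a finite set. -/
theorem card_le_of_lt_sum {β : Type*} (B : Finset β) (q : ℕ) (g : Fin q → β → ℝ)
    (M δ : ℝ) (hM : 0 < M) (hδ : 0 < δ) (hδ2 : δ ≤ 2) (hg : ∀ s, ∀ b ∈ B, |g s b| ≤ M)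
    (hmean : ∀ s, ∑ b ∈ B, g s b = 0) (F : Finset (Fin q → β))
    (hF : F ⊆ Fintype.piFinset fun _ => B) (hFg : ∀ v ∈ F, δ * q * M < ∑ s, g s (v s)) :
    (F.card : ℝ) ≤ Real.exp (-(δ ^ 2 * q / 4)) * (B.card : ℝ) ^ q := by
  -- With this choice the tail exponent `lam * (δ * q * M) = δ ^ 2 * q / 2` is twice what the
  -- exponential moments cost.
  set lam : ℝ := δ / (2 * M) with hlam
  have hlam0 : 0 < lam := by positivity
  have key : ∀ s, ∑ b ∈ B, Real.exp (lam * g s b) ≤ Real.exp (δ ^ 2 / 4) * B.card := by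
    intro s
    have h1 : ∀ b ∈ B, Real.exp (lam * g s b) ≤ (1 + δ ^ 2 / 4) + lam * g s b := by
      intro b hb
      have hx : |lam * g s b| ≤ δ / 2 := by
        rw [abs_mul, abs_of_pos hlam0]
        calc lam * |g s b| ≤ lam * M := by gcongr; exact hg s b hb
          _ = δ / 2 := by rw [hlam]; field_simp
      -- The inequality `exp x ≤ 1 + x + x ^ 2` needs `|x| ≤ 1`, whence `δ ≤ 2`; the linear term
      -- vanishes on summing over `B`.
      have h2 := (abs_le.1 (Real.abs_exp_sub_one_sub_id_le (hx.trans (by linarith)))).2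
      have h3 : (lam * g s b) ^ 2 ≤ (δ / 2) ^ 2 := by
        rw [← sq_abs]; gcongr
      nlinarith
    calc ∑ b ∈ B, Real.exp (lam * g s b) ≤ ∑ b ∈ B, ((1 + δ ^ 2 / 4) + lam * g s b) :=
          Finset.sum_le_sum h1
      _ = (1 + δ ^ 2 / 4) * B.card := by
          rw [Finset.sum_add_distrib, ← Finset.mul_sum, hmean s]; simp; ring
      _ ≤ _ := by
          gcongr
          linarith [Real.add_one_le_exp (δ ^ 2 / 4)]
  have h4 : ∑ v ∈ Fintype.piFinset (fun _ : Fin q => B), Real.exp (lam * ∑ s, g s (v s))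
      ≤ (Real.exp (δ ^ 2 / 4) * B.card) ^ q := by
    calc _ = ∑ v ∈ Fintype.piFinset (fun _ : Fin q => B), ∏ s, Real.exp (lam * g s (v s)) := by
          refine Finset.sum_congr rfl fun v _ => ?_
          rw [Finset.mul_sum, Real.exp_sum]
      _ = ∏ s, ∑ b ∈ B, Real.exp (lam * g s b) :=
          (Finset.prod_univ_sum (fun _ : Fin q => B) fun s b => Real.exp (lam * g s b)).symm
      _ ≤ ∏ _s : Fin q, (Real.exp (δ ^ 2 / 4) * B.card) :=
          Finset.prod_le_prod (fun s _ => Finset.sum_nonneg fun b _ => (Real.exp_pos _).le)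
            fun s _ => key s
      _ = _ := by simp
  have h5 : (F.card : ℝ) * Real.exp (δ ^ 2 * q / 2) ≤
      ∑ v ∈ Fintype.piFinset (fun _ : Fin q => B), Real.exp (lam * ∑ s, g s (v s)) := by
    calc (F.card : ℝ) * Real.exp (δ ^ 2 * q / 2)
        = ∑ _v ∈ F, Real.exp (δ ^ 2 * q / 2) := by simp
      _ ≤ ∑ v ∈ F, Real.exp (lam * ∑ s, g s (v s)) := by
          refine Finset.sum_le_sum fun v hv => Real.exp_le_exp.2 ?_
          have := (hFg v hv).le
          calc δ ^ 2 * q / 2 = lam * (δ * q * M) := by rw [hlam]; field_simp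
            _ ≤ _ := by gcongr
      _ ≤ _ := Finset.sum_le_sum_of_subset_of_nonneg hF
          fun _ _ _ => (Real.exp_pos _).le
  have h6 : (Real.exp (δ ^ 2 / 4) * B.card) ^ q = Real.exp (δ ^ 2 * q / 4) * (B.card : ℝ) ^ q := by
    rw [mul_pow, ← Real.exp_nat_mul]; congr 2; ring
  have h7 : Real.exp (δ ^ 2 * q / 2) * Real.exp (-(δ ^ 2 * q / 4)) = Real.exp (δ ^ 2 * q / 4) := by
    rw [← Real.exp_add]; congr 1; ring
  have h8 := h5.trans (h4.trans_eq h6)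
  rw [← h7] at h8
  have := Real.exp_pos (δ ^ 2 * q / 2)
  refine le_of_mul_le_mul_right ?_ this
  linarith

/-- Two-sided Chernoff bound for a sum of independent centred variables. -/
theorem card_le_of_lt_abs_sum {β : Type*} (B : Finset β) (q : ℕ) (g : Fin q → β → ℝ)
    (M δ : ℝ) (hM : 0 < M) (hδ : 0 < δ) (hδ2 : δ ≤ 2) (hg : ∀ s, ∀ b ∈ B, |g s b| ≤ M)
    (hmean : ∀ s, ∑ b ∈ B, g s b = 0) (F : Finset (Fin q → β))
    (hF : F ⊆ Fintype.piFinset fun _ => B) (hFg : ∀ v ∈ F, δ * q * M < |∑ s, g s (v s)|) :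
    (F.card : ℝ) ≤ 2 * Real.exp (-(δ ^ 2 * q / 4)) * (B.card : ℝ) ^ q := by
  classical
  have h1 := card_le_of_lt_sum B q g M δ hM hδ hδ2 hg hmean
    (F.filter fun v => δ * q * M < ∑ s, g s (v s)) ((Finset.filter_subset _ _).trans hF)
    fun v hv => (Finset.mem_filter.1 hv).2
  have h2 := card_le_of_lt_sum B q (fun s b => -g s b) M δ hM hδ hδ2
    (by simpa using hg) (by simpa using hmean)
    (F.filter fun v => ¬ δ * q * M < ∑ s, g s (v s)) ((Finset.filter_subset _ _).trans hF) <| by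
      intro v hv
      obtain ⟨hv, hn⟩ := Finset.mem_filter.1 hv
      simpa using (lt_abs.1 (hFg v hv)).resolve_left hn
  have h3 := F.card_filter_add_card_filter_not fun v => δ * q * M < ∑ s, g s (v s)
  have h4 : (F.card : ℝ) = _ := congrArg Nat.cast h3.symm
  push_cast at h4
  linarith

/-- Passing to a subset of relative size at least `1 - η` changes the average of a `[0,1]`-valued
function by at most `2η`. -/
theorem abs_average_sub_average_le {ι : Type*} (G Ω : Finset ι) (hG : G ⊆ Ω) (hΩ : Ω.Nonempty)
    (η : ℝ) (hη : η ≤ 1 / 2) (hcard : (1 - η) * Ω.card ≤ G.card) (g : ι → ℝ)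
    (hg0 : ∀ i ∈ Ω, 0 ≤ g i) (hg1 : ∀ i ∈ Ω, g i ≤ 1) :
    |(∑ i ∈ G, g i) / G.card - (∑ i ∈ Ω, g i) / Ω.card| ≤ 2 * η := by
  classical
  have hΩ0 : (0 : ℝ) < Ω.card := by exact_mod_cast hΩ.card_pos
  have hG0 : (0 : ℝ) < G.card := by nlinarith
  have hle : (G.card : ℝ) ≤ Ω.card := by exact_mod_cast Finset.card_le_card hG
  have hη0 : 0 ≤ η := by
    by_contra h
    push Not at h
    nlinarith
  have h1 : ∑ i ∈ G, g i ≤ ∑ i ∈ Ω, g i :=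
    Finset.sum_le_sum_of_subset_of_nonneg hG fun i hi _ => hg0 i hi
  have h2 : ∑ i ∈ Ω, g i ≤ ∑ i ∈ G, g i + (Ω.card - G.card) := by
    rw [← Finset.sum_sdiff hG, add_comm]
    have : ∑ i ∈ Ω \ G, g i ≤ ∑ i ∈ Ω \ G, (1 : ℝ) :=
      Finset.sum_le_sum fun i hi => hg1 i (Finset.sdiff_subset hi)
    rw [Finset.sum_const, nsmul_eq_mul, mul_one, Finset.card_sdiff_of_subset hG,
      Nat.cast_sub (Finset.card_le_card hG)] at this
    linarith
  have h3 : ∑ i ∈ G, g i ≤ G.card := by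
    have : ∑ i ∈ G, g i ≤ ∑ i ∈ G, (1 : ℝ) := Finset.sum_le_sum fun i hi => hg1 i (hG hi)
    simpa using this
  have h4 : 0 ≤ ∑ i ∈ G, g i := Finset.sum_nonneg fun i hi => hg0 i (hG hi)
  rw [div_sub_div _ _ hG0.ne' hΩ0.ne', abs_le, le_div_iff₀ (by positivity),
    div_le_iff₀ (by positivity)]
  constructor
  · nlinarith [mul_nonneg hη0 hG0.le, mul_nonneg hη0 hΩ0.le, mul_pos hG0 hΩ0,
      mul_nonneg (mul_nonneg hη0 hG0.le) hΩ0.le,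
      mul_le_mul_of_nonneg_left h2 hG0.le, mul_le_mul_of_nonneg_right hcard hG0.le,
      mul_nonneg h4 (sub_nonneg.2 hle)]
  · have : (Ω.card : ℝ) - G.card ≤ η * Ω.card := by linarith
    nlinarith [mul_le_mul_of_nonneg_left this h4, mul_le_mul_of_nonneg_left h1 hG0.le,
      mul_le_mul_of_nonneg_left h3 (mul_nonneg hη0 hΩ0.le),
      mul_nonneg (mul_nonneg hη0 hG0.le) hΩ0.le]

end Probability

section Sums

theorem sum_range_mul_eq {M : Type*} [AddCommMonoid M] (q p : ℕ) (g : ℕ → M) :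
    ∑ i ∈ Finset.range (q * p), g i =
      ∑ s ∈ Finset.range q, ∑ j ∈ Finset.range p, g (s * p + j) := by
  induction q with
  | zero => simp
  | succ q ih => rw [Nat.succ_mul, Finset.sum_range_add, ih, Finset.sum_range_succ]

end Sums

/-! ### The hierarchy of blocks and the proportion of unbalanced concatenations. -/

namespace BlockShift

/-- The length of the blocks of level `k`. -/
def period (P k : ℕ) : ℕ := P ^ 5 ^ k

theorem period_zero (P : ℕ) : period P 0 = P := by simp [period]

/-- The fifth power is what lets `p ^ 4` summands tested at relative precision `1 / p` yield an
exponent quadratic in `p`, larger than the `p log N` of the number of words. -/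
theorem period_succ (P k : ℕ) : period P (k + 1) = period P k ^ 4 * period P k := by
  rw [period, period, pow_succ 5, pow_mul, pow_succ]

theorem period_pos {P : ℕ} (hP : 2 ≤ P) (k : ℕ) : 0 < period P k := Nat.pow_pos (by omega)

theorem le_period (P k : ℕ) : P ≤ period P k :=
  Nat.le_self_pow (by positivity) P

theorem two_mul_period_le {P : ℕ} (hP : 2 ≤ P) (k : ℕ) : 2 * period P k ≤ period P (k + 1) := by
  rw [period_succ]
  have := hP.trans (le_period P k)
  gcongr
  exact this.trans (Nat.le_self_pow (by norm_num) _)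

theorem period_strictMono {P : ℕ} (hP : 2 ≤ P) : StrictMono (period P) :=
  strictMono_nat_of_lt_succ fun k => by
    have := two_mul_period_le hP k
    have := period_pos hP k
    omega

theorem succ_le_period {P : ℕ} (hP : 2 ≤ P) (k : ℕ) : k + 1 ≤ period P k := by
  induction k with
  | zero => have := period_pos hP 0; omega
  | succ k ih => have := two_mul_period_le hP k; omega

theorem period_dvd (P : ℕ) {k m : ℕ} (h : k ≤ m) : period P k ∣ period P m :=
  pow_dvd_pow P (Nat.pow_le_pow_right (by norm_num) h)

variable {A : Type*}

/-- The sequence `x` starts with the word `w`. -/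
def StartsWith (w : List A) (x : ℕ → A) : Prop := ∀ i (h : i < w.length), x i = w[i]

/-- The word `w` occurs in `x` at position `j`, inside the window `[0, p)`. -/
def OccursIn (w : List A) (p : ℕ) (x : ℕ → A) (j : ℕ) : Prop :=
  j + w.length ≤ p ∧ StartsWith w fun i => x (j + i)

open Classical in
/-- The indicator of `StartsWith`. -/
noncomputable def ind (w : List A) (x : ℕ → A) : ℝ := if StartsWith w x then 1 else 0

open Classical in
/-- The indicator of `OccursIn`. -/
noncomputable def occ (w : List A) (p : ℕ) (x : ℕ → A) (j : ℕ) : ℝ :=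
  if OccursIn w p x j then 1 else 0

theorem occ_nonneg (w : List A) (p : ℕ) (x : ℕ → A) (j : ℕ) : 0 ≤ occ w p x j := by
  unfold occ; split_ifs <;> norm_num

theorem occ_le_one (w : List A) (p : ℕ) (x : ℕ → A) (j : ℕ) : occ w p x j ≤ 1 := by
  unfold occ; split_ifs <;> norm_num

theorem ind_nonneg (w : List A) (x : ℕ → A) : 0 ≤ ind w x := by
  unfold ind; split_ifs <;> norm_num

theorem ind_le_one (w : List A) (x : ℕ → A) : ind w x ≤ 1 := by
  unfold ind; split_ifs <;> norm_num

/-- The relative frequency, among the elements of `B`, of occurrences of `w` at `j`. -/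
noncomputable def freq (B : Finset (ℕ → A)) (w : List A) (p j : ℕ) : ℝ :=
  (∑ b ∈ B, occ w p b j) / B.card

theorem freq_nonneg (B : Finset (ℕ → A)) (w : List A) (p j : ℕ) : 0 ≤ freq B w p j :=
  div_nonneg (Finset.sum_nonneg fun _ _ => occ_nonneg ..) (Nat.cast_nonneg _)

theorem freq_le_one (B : Finset (ℕ → A)) (w : List A) (p j : ℕ) : freq B w p j ≤ 1 := by
  refine div_le_one_of_le₀ ?_ (Nat.cast_nonneg _)
  have : ∑ b ∈ B, occ w p b j ≤ ∑ b ∈ B, (1 : ℝ) := Finset.sum_le_sum fun _ _ => occ_le_one ..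
  simpa using this

theorem abs_occ_sub_freq_le (B : Finset (ℕ → A)) (w : List A) (p : ℕ) (x : ℕ → A) (j : ℕ) :
    |occ w p x j - freq B w p j| ≤ 1 := by
  have h1 := occ_nonneg w p x j
  have h2 := occ_le_one w p x j
  have h3 := freq_nonneg B w p j
  have h4 := freq_le_one B w p j
  rw [abs_le]; constructor <;> linarith

variable [Inhabited A]

/-- The concatenation of `q` words of length `p`, extended by a default symbol. -/
def concat (p q : ℕ) (v : Fin q → ℕ → A) (i : ℕ) : A :=
  if h : i / p < q then v ⟨i / p, h⟩ (i % p) else default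

theorem concat_apply {p q : ℕ} (v : Fin q → ℕ → A) (s : Fin q) {j : ℕ} (hj : j < p) :
    concat p q v (s * p + j) = v s j := by
  have h1 : (s * p + j) / p = s := by
    rw [mul_comm, Nat.mul_add_div (by omega), Nat.div_eq_of_lt hj, add_zero]
  have h2 : (s * p + j) % p = j := by
    rw [mul_comm, Nat.mul_add_mod, Nat.mod_eq_of_lt hj]
  simp [concat, h1, h2]

/-- The concatenation `v` of blocks from `B` has, for each of the words `W 0, …, W k` and each
weight `Z c` started at any `i < J`, nearly the weighted number of occurrences expected of a random
concatenation. -/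
def Balanced (W : ℕ → List A) (Z : Bool → ℕ → ℝ) (k p q J : ℕ) (B : Finset (ℕ → A))
    (v : Fin q → ℕ → A) : Prop :=
  ∀ l ≤ k, ∀ c, ∀ i < J,
    |∑ s : Fin q, ∑ j ∈ Finset.range p,
      (occ (W l) p (v s) j - freq B (W l) p j) * Z c (i + s * p + j)| ≤ q

variable [Fintype A]

open Classical in
/-- The blocks of level `k`: at level `0` all words of length `P`, at level `k + 1` the balanced
concatenations of blocks of level `k`. -/
noncomputable def blocks (P : ℕ) (W : ℕ → List A) (Z : Bool → ℕ → ℝ) : ℕ → Finset (ℕ → A)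
  | 0 => Finset.univ.image fun (u : Fin P → A) i => if h : i < P then u ⟨i, h⟩ else default
  | k + 1 =>
    ((Fintype.piFinset fun _ : Fin (period P k ^ 4) => blocks P W Z k).filter
      (Balanced W Z k (period P k) (period P k ^ 4) (period P (k + 1) ^ 10)
        (blocks P W Z k))).image (concat (period P k) (period P k ^ 4))

variable (P : ℕ) (W : ℕ → List A) (Z : Bool → ℕ → ℝ)

theorem mem_blocks_succ {k : ℕ} {b : ℕ → A} : b ∈ blocks P W Z (k + 1) ↔
    ∃ v : Fin (period P k ^ 4) → ℕ → A, (∀ s, v s ∈ blocks P W Z k) ∧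
      Balanced W Z k (period P k) (period P k ^ 4) (period P (k + 1) ^ 10) (blocks P W Z k) v ∧
      concat (period P k) (period P k ^ 4) v = b := by
  simp [blocks, Fintype.mem_piFinset, and_assoc]

variable {P W Z}

theorem eq_default_of_mem_blocks (hP : 2 ≤ P) {k : ℕ} {b : ℕ → A} (hb : b ∈ blocks P W Z k)
    {i : ℕ} (hi : period P k ≤ i) : b i = default := by
  cases k with
  | zero =>
    rw [period_zero] at hi
    simp only [blocks, Finset.mem_image, Finset.mem_univ, true_and] at hb
    obtain ⟨u, rfl⟩ := hb
    simp [hi]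
  | succ k =>
    obtain ⟨v, -, -, rfl⟩ := (mem_blocks_succ P W Z).1 hb
    rw [concat, dif_neg]
    rw [period_succ] at hi
    rw [not_lt, Nat.le_div_iff_mul_le (period_pos hP k)]
    exact hi

/-- Blocks take the default value beyond their period, so agreement on the period is equality.
Counting blocks therefore amounts to counting balanced tuples. -/
theorem concat_injOn_blocks (hP : 2 ≤ P) (k q : ℕ) :
    Set.InjOn (concat (period P k) q)
      {v : Fin q → ℕ → A | ∀ s, v s ∈ blocks P W Z k} := by
  intro v hv v' hv' h
  funext s j
  by_cases hj : j < period P k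
  · rw [← concat_apply v s hj, ← concat_apply v' s hj, h]
  · rw [eq_default_of_mem_blocks hP (hv s) (not_lt.1 hj),
      eq_default_of_mem_blocks hP (hv' s) (not_lt.1 hj)]

theorem card_blocks_zero : (blocks P W Z 0).card = Fintype.card A ^ P := by
  classical
  rw [blocks, Finset.card_image_of_injective]
  · simp
  · intro u u' h
    funext i
    simpa using congrFun h i

open Classical in
theorem card_blocks_succ (hP : 2 ≤ P) (k : ℕ) : (blocks P W Z (k + 1)).card =
    ((Fintype.piFinset fun _ : Fin (period P k ^ 4) => blocks P W Z k).filter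
      (Balanced W Z k (period P k) (period P k ^ 4) (period P (k + 1) ^ 10)
        (blocks P W Z k))).card := by
  rw [blocks, Finset.card_image_of_injOn]
  refine (concat_injOn_blocks (W := W) (Z := Z) hP k _).mono fun v hv => ?_
  exact Fintype.mem_piFinset.1 (Finset.mem_filter.1 hv).1

theorem card_blocks_le (hP : 2 ≤ P) (k : ℕ) :
    (blocks P W Z k).card ≤ Fintype.card A ^ period P k := by
  induction k with
  | zero => rw [card_blocks_zero, period_zero]
  | succ k ih =>
    classical
    rw [card_blocks_succ hP]
    refine (Finset.card_filter_le _ _).trans ?_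
    rw [Fintype.card_piFinset_const, period_succ, mul_comm, pow_mul]
    gcongr

/-- A bound for the proportion of unbalanced concatenations at level `k`. -/
noncomputable def defect (A : Type*) [Fintype A] (P k : ℕ) : ℝ :=
  1 / (8 * period P k * (Fintype.card A : ℝ) ^ period P k)

theorem exp_bound_le_inv {N p k : ℕ} (hN : 1 ≤ N) (hp : 4 * (60 + N) ≤ p) (hk : k + 1 ≤ p) :
    ((k : ℝ) + 1) * (2 * ((p : ℝ) ^ 50 * (2 * Real.exp (-((p : ℝ) ^ 2 / 4))))) ≤
      1 / (8 * p * (N : ℝ) ^ p) := by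
  have hp0 : (0 : ℝ) < p := by exact_mod_cast (by omega : 0 < p)
  have hN0 : (0 : ℝ) < N := by exact_mod_cast hN
  have hk' : (k : ℝ) + 1 ≤ p := by exact_mod_cast hk
  have hpe : (p : ℝ) ≤ Real.exp p := by linarith [Real.add_one_le_exp (p : ℝ)]
  have hNe : (N : ℝ) ≤ Real.exp N := by linarith [Real.add_one_le_exp (N : ℝ)]
  have h32 : (32 : ℝ) ≤ p := by exact_mod_cast (by omega : 32 ≤ p)
  rw [le_div_iff₀ (by positivity)]
  have h1 : (32 : ℝ) * p ^ 52 * N ^ p ≤ Real.exp ((p : ℝ) ^ 2 / 4) := by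
    calc (32 : ℝ) * p ^ 52 * N ^ p ≤ p * p ^ 52 * N ^ p := by gcongr
      _ = (p : ℝ) ^ 53 * (N : ℝ) ^ p := by ring
      _ ≤ Real.exp p ^ 53 * Real.exp N ^ p := by gcongr
      _ = Real.exp (53 * p + p * N) := by
          rw [← Real.exp_nat_mul, ← Real.exp_nat_mul, ← Real.exp_add]; norm_num
      _ ≤ _ := by
          refine Real.exp_le_exp.2 ?_
          have : (4 : ℝ) * (60 + N) ≤ p := by exact_mod_cast hp
          nlinarith
  calc _ = ((k : ℝ) + 1) * (32 * p ^ 51 * N ^ p) * Real.exp (-((p : ℝ) ^ 2 / 4)) := by ring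
    _ ≤ p * (32 * p ^ 51 * N ^ p) * Real.exp (-((p : ℝ) ^ 2 / 4)) := by gcongr
    _ = (32 * p ^ 52 * N ^ p) * Real.exp (-((p : ℝ) ^ 2 / 4)) := by ring
    _ ≤ Real.exp ((p : ℝ) ^ 2 / 4) * Real.exp (-((p : ℝ) ^ 2 / 4)) := by gcongr
    _ = 1 := by rw [← Real.exp_add]; simp

-- Union bound over `k + 1` words, two weights and `p ^ 50` starting positions. Only occurrences
-- inside a sub-block are counted, so the deviation is a sum of functions of the separate,
-- independent sub-blocks.
open Classical in
theorem card_unbalanced_le (hP : 4 * (60 + Fintype.card A) ≤ P) (hZ : ∀ c i, |Z c i| ≤ 1) (k : ℕ)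
    (hne : (blocks P W Z k).Nonempty) :
    ((((Fintype.piFinset fun _ : Fin (period P k ^ 4) => blocks P W Z k).filter fun v =>
      ¬ Balanced W Z k (period P k) (period P k ^ 4) (period P (k + 1) ^ 10)
        (blocks P W Z k) v).card : ℕ) : ℝ) ≤
      defect A P k * ((blocks P W Z k).card : ℝ) ^ (period P k ^ 4) := by
  have hP2 : 2 ≤ P := by omega
  set B := blocks P W Z k
  set p := period P k with hp
  have hppos : (0 : ℝ) < p := by exact_mod_cast period_pos hP2 k
  have hp1 : (1 : ℝ) ≤ p := by exact_mod_cast period_pos hP2 k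
  set Ω := Fintype.piFinset fun _ : Fin (p ^ 4) => B
  have hB0 : (0 : ℝ) < B.card := by exact_mod_cast hne.card_pos
  let dev (l : ℕ) (c : Bool) (i : ℕ) (s : Fin (p ^ 4)) (b : ℕ → A) : ℝ :=
    ∑ j ∈ Finset.range p, (occ (W l) p b j - freq B (W l) p j) * Z c (i + s * p + j)
  let bad (l : ℕ) (c : Bool) (i : ℕ) : Finset (Fin (p ^ 4) → ℕ → A) :=
    Ω.filter fun v => ((p ^ 4 : ℕ) : ℝ) < |∑ s, dev l c i s (v s)|
  have hbad : ∀ l c i, ((bad l c i).card : ℝ) ≤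
      2 * Real.exp (-((p : ℝ) ^ 2 / 4)) * (B.card : ℝ) ^ (p ^ 4) := by
    intro l c i
    -- A sub-block deviates by at most `p`; relative precision `1 / p` gives the threshold `p ^ 4`
    -- and the exponent `p ^ 2 / 4`.
    have := card_le_of_lt_abs_sum B (p ^ 4) (dev l c i) p (1 / p) hppos (by positivity)
      ((div_le_one hppos).2 hp1 |>.trans (by norm_num)) ?_ ?_ (bad l c i)
      (Finset.filter_subset _ _) ?_
    · convert this using 4
      push_cast; field_simp
    · intro s b _
      refine (Finset.abs_sum_le_sum_abs _ _).trans ?_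
      calc _ ≤ ∑ j ∈ Finset.range p, (1 : ℝ) := by
            refine Finset.sum_le_sum fun j _ => ?_
            rw [abs_mul]
            exact mul_le_one₀ (abs_occ_sub_freq_le ..) (abs_nonneg _) (hZ _ _)
        _ = p := by simp
    · intro s
      rw [Finset.sum_comm]
      refine Finset.sum_eq_zero fun j _ => ?_
      rw [← Finset.sum_mul, Finset.sum_sub_distrib, Finset.sum_const, nsmul_eq_mul, freq,
        mul_div_cancel₀ _ hB0.ne', sub_self, zero_mul]
    · intro v hv
      have := (Finset.mem_filter.1 hv).2
      convert this using 1
      field_simp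
  have hsub : (Ω.filter fun v => ¬ Balanced W Z k p (p ^ 4) (period P (k + 1) ^ 10) B v) ⊆
      (Finset.range (k + 1)).biUnion fun l => Finset.univ.biUnion fun c =>
        (Finset.range (period P (k + 1) ^ 10)).biUnion fun i => bad l c i := by
    intro v hv
    obtain ⟨hv, hn⟩ := Finset.mem_filter.1 hv
    unfold Balanced at hn
    push Not at hn
    obtain ⟨l, hl, c, i, hi, h⟩ := hn
    simp only [Finset.mem_biUnion, Finset.mem_range, Finset.mem_univ, true_and]
    exact ⟨l, by omega, c, i, hi, Finset.mem_filter.2 ⟨hv, h⟩⟩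
  have hcard : ∀ (F : Finset (Fin (p ^ 4) → ℕ → A)), F ⊆
      ((Finset.range (k + 1)).biUnion fun l => Finset.univ.biUnion fun c =>
        (Finset.range (period P (k + 1) ^ 10)).biUnion fun i => bad l c i) →
      (F.card : ℝ) ≤ ∑ l ∈ Finset.range (k + 1), ∑ c : Bool,
        ∑ i ∈ Finset.range (period P (k + 1) ^ 10), ((bad l c i).card : ℝ) := by
    intro F hF
    have : F.card ≤ ∑ l ∈ Finset.range (k + 1), ∑ c : Bool,
        ∑ i ∈ Finset.range (period P (k + 1) ^ 10), (bad l c i).card :=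
      (Finset.card_le_card hF).trans <| Finset.card_biUnion_le.trans <|
        Finset.sum_le_sum fun l _ => Finset.card_biUnion_le.trans <|
          Finset.sum_le_sum fun c _ => Finset.card_biUnion_le
    exact_mod_cast this
  refine (hcard _ hsub).trans ?_
  calc _ ≤ ∑ l ∈ Finset.range (k + 1), ∑ c : Bool,
        ∑ i ∈ Finset.range (period P (k + 1) ^ 10),
          2 * Real.exp (-((p : ℝ) ^ 2 / 4)) * (B.card : ℝ) ^ (p ^ 4) :=
        Finset.sum_le_sum fun l _ => Finset.sum_le_sum fun c _ =>
          Finset.sum_le_sum fun i _ => hbad l c i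
    _ = ((k : ℝ) + 1) * (2 * ((p : ℝ) ^ 50 * (2 * Real.exp (-((p : ℝ) ^ 2 / 4))))) *
          (B.card : ℝ) ^ (p ^ 4) := by
        have : ((period P (k + 1) ^ 10 : ℕ) : ℝ) = (p : ℝ) ^ 50 := by
          rw [period_succ, ← hp]; push_cast; ring
        simp only [Finset.sum_const, Finset.card_range, nsmul_eq_mul, this, Finset.card_univ,
          Fintype.card_bool]
        push_cast
        ring
    _ ≤ _ := by
        gcongr
        exact exp_bound_le_inv Fintype.card_pos (hP.trans (le_period P k)) (succ_le_period hP2 k)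

theorem defect_pos (hP : 2 ≤ P) (k : ℕ) : 0 < defect A P k := by
  have := period_pos hP k
  have : 0 < Fintype.card A := Fintype.card_pos
  unfold defect; positivity

theorem defect_le (hP : 2 ≤ P) (k : ℕ) : defect A P k ≤ 1 / (8 * period P k) := by
  have h1 : (0 : ℝ) < period P k := by exact_mod_cast period_pos hP k
  have h2 : (1 : ℝ) ≤ (Fintype.card A : ℝ) ^ period P k :=
    one_le_pow₀ (by exact_mod_cast (Fintype.card_pos : 0 < Fintype.card A))
  unfold defect
  refine one_div_le_one_div_of_le (by positivity) ?_
  nlinarith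

theorem defect_le_half (hP : 2 ≤ P) (k : ℕ) : defect A P k ≤ 1 / 2 := by
  refine (defect_le hP k).trans ?_
  have h1 : (1 : ℝ) ≤ period P k := by exact_mod_cast period_pos hP k
  rw [div_le_div_iff₀ (by positivity) (by positivity)]
  linarith

/-- Geometric decay makes all later losses summable, with sum controlled by the first one. -/
theorem two_mul_defect_succ_le (hP : 2 ≤ P) (k : ℕ) : 2 * defect A P (k + 1) ≤ defect A P k := by
  have h0 : (0 : ℝ) < period P k := by exact_mod_cast period_pos hP k
  have hA : (1 : ℝ) ≤ Fintype.card A := by exact_mod_cast (Fintype.card_pos : 0 < Fintype.card A)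
  have h1 : (2 : ℝ) * period P k ≤ period P (k + 1) := by exact_mod_cast two_mul_period_le hP k
  have h2 : (Fintype.card A : ℝ) ^ period P k ≤ (Fintype.card A : ℝ) ^ period P (k + 1) :=
    pow_le_pow_right₀ hA ((period_strictMono hP).monotone (Nat.le_succ k))
  have h3 : (0 : ℝ) < (Fintype.card A : ℝ) ^ period P k := by positivity
  have h4 : (0 : ℝ) < period P (k + 1) := by linarith
  unfold defect
  rw [mul_one_div, div_le_div_iff₀ (by positivity) (by positivity)]
  nlinarith [mul_le_mul h1 h2 h3.le (by positivity)]

theorem le_card_blocks_succ (hP : 4 * (60 + Fintype.card A) ≤ P) (hZ : ∀ c i, |Z c i| ≤ 1) (k : ℕ)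
    (hne : (blocks P W Z k).Nonempty) :
    (1 - defect A P k) * ((blocks P W Z k).card : ℝ) ^ (period P k ^ 4) ≤
      (blocks P W Z (k + 1)).card := by
  classical
  have h1 := card_unbalanced_le hP hZ k hne
  have h2 := congrArg (Nat.cast (R := ℝ)) <|
    (Fintype.piFinset fun _ : Fin (period P k ^ 4) => blocks P W Z k).card_filter_add_card_filter_not
      (Balanced W Z k (period P k) (period P k ^ 4) (period P (k + 1) ^ 10) (blocks P W Z k))
  rw [← card_blocks_succ (by omega), Fintype.card_piFinset_const] at h2
  push_cast at h2
  linarith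

theorem blocks_nonempty (hP : 4 * (60 + Fintype.card A) ≤ P) (hZ : ∀ c i, |Z c i| ≤ 1) (k : ℕ) :
    (blocks P W Z k).Nonempty := by
  induction k with
  | zero =>
    rw [← Finset.card_pos, card_blocks_zero]
    exact Nat.pow_pos Fintype.card_pos
  | succ k ih =>
    have h1 := le_card_blocks_succ hP hZ k ih
    have h2 := defect_le_half (A := A) (by omega : 2 ≤ P) k
    have h3 : (0 : ℝ) < (blocks P W Z k).card := by exact_mod_cast ih.card_pos
    rw [← Finset.card_pos]
    have : (0 : ℝ) < (blocks P W Z (k + 1)).card :=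
      lt_of_lt_of_le (mul_pos (by linarith) (by positivity)) h1
    exact_mod_cast this

end BlockShift

/-! ### Drift of the positional frequencies from level to level. -/

namespace BlockShift

variable {A : Type*}

theorem sum_range_ite_lt_add_le (p r : ℕ) :
    ∑ i ∈ Finset.range p, (if p < i + r then (1 : ℝ) else 0) ≤ r := by
  rw [← Finset.sum_filter, Finset.sum_const, nsmul_eq_mul, mul_one, Nat.cast_le]
  calc ((Finset.range p).filter fun i => p < i + r).card ≤ (Finset.Ico (p - r) p).card := by
        refine Finset.card_le_card fun i hi => ?_
        simp only [Finset.mem_filter, Finset.mem_range, Finset.mem_Ico] at hi ⊢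
        omega
    _ ≤ r := by simp; omega

variable [Inhabited A]

theorem OccursIn.concat {w : List A} {p q : ℕ} {v : Fin q → ℕ → A} {s : Fin q} {i : ℕ}
    (h : OccursIn w p (v s) i) : OccursIn w (q * p) (concat p q v) (s * p + i) := by
  refine ⟨?_, fun t ht => ?_⟩
  · have h1 : (s + 1) * p ≤ q * p := Nat.mul_le_mul_right p s.2
    have := h.1
    rw [Nat.succ_mul] at h1
    omega
  · have := h.1
    have h2 := h.2 t ht
    simp only at h2 ⊢
    rw [add_assoc, concat_apply v s (by omega), h2]

theorem occursIn_concat_iff {w : List A} {p q : ℕ} {v : Fin q → ℕ → A} {s : Fin q} {i : ℕ}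
    (hi : i + w.length ≤ p) :
    OccursIn w (q * p) (concat p q v) (s * p + i) ↔ OccursIn w p (v s) i := by
  refine ⟨fun h => ⟨hi, fun t ht => ?_⟩, OccursIn.concat⟩
  have := h.2 t ht
  simp only at this ⊢
  rwa [add_assoc, concat_apply v s (by omega)] at this

theorem occ_le_occ_concat (w : List A) {p q : ℕ} (v : Fin q → ℕ → A) (s : Fin q) (i : ℕ) :
    occ w p (v s) i ≤ occ w (q * p) (concat p q v) (s * p + i) := by
  classical
  by_cases h : OccursIn w p (v s) i
  · rw [occ, if_pos h, occ, if_pos h.concat]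
  · rw [occ, if_neg h]
    exact occ_nonneg ..

theorem occ_concat_eq (w : List A) {p q : ℕ} (v : Fin q → ℕ → A) (s : Fin q) {i : ℕ}
    (hi : i + w.length ≤ p) :
    occ w (q * p) (concat p q v) (s * p + i) = occ w p (v s) i := by
  classical
  unfold occ
  exact if_congr (occursIn_concat_iff hi) rfl rfl

variable [Fintype A] {P : ℕ} {W : ℕ → List A} {Z : Bool → ℕ → ℝ}

open Classical in
theorem freq_blocks_succ (hP : 2 ≤ P) (w : List A) (k n j : ℕ) :
    freq (blocks P W Z (k + 1)) w n j =
      (∑ v ∈ (Fintype.piFinset fun _ : Fin (period P k ^ 4) => blocks P W Z k).filter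
        (Balanced W Z k (period P k) (period P k ^ 4) (period P (k + 1) ^ 10) (blocks P W Z k)),
        occ w n (concat (period P k) (period P k ^ 4) v) j) /
      ((Fintype.piFinset fun _ : Fin (period P k ^ 4) => blocks P W Z k).filter
        (Balanced W Z k (period P k) (period P k ^ 4) (period P (k + 1) ^ 10)
          (blocks P W Z k))).card := by
  rw [freq, card_blocks_succ hP, blocks, Finset.sum_image]
  intro v hv v' hv' h
  exact concat_injOn_blocks (W := W) (Z := Z) hP k _
    (Fintype.mem_piFinset.1 (Finset.mem_filter.1 hv).1)
    (Fintype.mem_piFinset.1 (Finset.mem_filter.1 hv').1) h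

-- In the full product every coordinate is exactly uniform on the blocks; restricting to the
-- balanced tuples removes only a proportion `defect`.
open Classical in
theorem abs_average_occ_sub_freq_le (hP : 4 * (60 + Fintype.card A) ≤ P)
    (hZ : ∀ c i, |Z c i| ≤ 1) (w : List A) (k : ℕ) (s : Fin (period P k ^ 4)) (i : ℕ) :
    |(∑ v ∈ (Fintype.piFinset fun _ : Fin (period P k ^ 4) => blocks P W Z k).filter
        (Balanced W Z k (period P k) (period P k ^ 4) (period P (k + 1) ^ 10) (blocks P W Z k)),
        occ w (period P k) (v s) i) /
      ((Fintype.piFinset fun _ : Fin (period P k ^ 4) => blocks P W Z k).filter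
        (Balanced W Z k (period P k) (period P k ^ 4) (period P (k + 1) ^ 10)
          (blocks P W Z k))).card - freq (blocks P W Z k) w (period P k) i| ≤
      2 * defect A P k := by
  have hP2 : 2 ≤ P := by omega
  have hne := blocks_nonempty (W := W) hP hZ k
  have hB : (0 : ℝ) < (blocks P W Z k).card := by exact_mod_cast hne.card_pos
  have h1 : freq (blocks P W Z k) w (period P k) i =
      (∑ v ∈ Fintype.piFinset fun _ : Fin (period P k ^ 4) => blocks P W Z k,
        occ w (period P k) (v s) i) /
      (Fintype.piFinset fun _ : Fin (period P k ^ 4) => blocks P W Z k).card := by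
    rw [Fintype.sum_piFinset_apply (fun b => occ w (period P k) b i), Fintype.card_piFinset_const,
      freq, Fintype.card_fin, nsmul_eq_mul]
    -- A block in coordinate `s` extends to `|B| ^ (q - 1)` tuples, so one factor has to be split
    -- off.
    have : period P k ^ 4 = (period P k ^ 4 - 1) + 1 := by have := s.2; omega
    generalize period P k ^ 4 - 1 = d at this ⊢
    rw [this]
    push_cast
    rw [pow_succ]
    field_simp
  rw [h1]
  refine abs_average_sub_average_le _ _ (Finset.filter_subset _ _)
    (Fintype.piFinset_nonempty.2 fun _ => hne) _ (defect_le_half hP2 k) ?_ _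
    (fun _ _ => occ_nonneg ..) fun _ _ => occ_le_one ..
  rw [← card_blocks_succ hP2, Fintype.card_piFinset_const]
  exact_mod_cast le_card_blocks_succ hP hZ k hne

/-- Occurrences inside a sub-block persist in the concatenation, so the lower bound pays nothing at
sub-block boundaries. Such a cost would swamp the tiny frequencies used for minimality. -/
theorem freq_sub_le_freq_succ (hP : 4 * (60 + Fintype.card A) ≤ P)
    (hZ : ∀ c i, |Z c i| ≤ 1) (w : List A) (k : ℕ) {s : ℕ} (hs : s < period P k ^ 4) (i : ℕ) :
    freq (blocks P W Z k) w (period P k) i - 2 * defect A P k ≤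
      freq (blocks P W Z (k + 1)) w (period P (k + 1)) (s * period P k + i) := by
  classical
  have h1 := (abs_le.1 (abs_average_occ_sub_freq_le (W := W) hP hZ w k ⟨s, hs⟩ i)).1
  rw [freq_blocks_succ (by omega)]
  refine le_trans (by linarith only [h1]) (div_le_div_of_nonneg_right
    (Finset.sum_le_sum (f := fun v => occ w (period P k) (v ⟨s, hs⟩) i) fun v _ => ?_)
    (Nat.cast_nonneg _))
  rw [period_succ]
  exact occ_le_occ_concat w v ⟨s, hs⟩ i

theorem abs_freq_succ_sub_le (hP : 4 * (60 + Fintype.card A) ≤ P)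
    (hZ : ∀ c i, |Z c i| ≤ 1) (w : List A) (k : ℕ) {s : ℕ} (hs : s < period P k ^ 4) {i : ℕ}
    (hi : i + w.length ≤ period P k) :
    |freq (blocks P W Z (k + 1)) w (period P (k + 1)) (s * period P k + i) -
      freq (blocks P W Z k) w (period P k) i| ≤ 2 * defect A P k := by
  classical
  rw [freq_blocks_succ (by omega)]
  have h : ∀ v : Fin (period P k ^ 4) → ℕ → A, occ w (period P (k + 1))
      (concat (period P k) (period P k ^ 4) v) (s * period P k + i) =
        occ w (period P k) (v ⟨s, hs⟩) i := fun v => by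
    rw [period_succ]
    exact occ_concat_eq w v ⟨s, hs⟩ hi
  simp only [h]
  exact abs_average_occ_sub_freq_le hP hZ w k ⟨s, hs⟩ i

theorem sum_abs_freq_succ_sub_le (hP : 4 * (60 + Fintype.card A) ≤ P)
    (hZ : ∀ c i, |Z c i| ≤ 1) (w : List A) (k : ℕ) :
    ∑ j ∈ Finset.range (period P (k + 1)),
      |freq (blocks P W Z (k + 1)) w (period P (k + 1)) j -
        freq (blocks P W Z k) w (period P k) (j % period P k)| ≤
      (period P k : ℝ) ^ 4 * (w.length + 1) := by
  have hP2 : 2 ≤ P := by omega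
  have hp : (0 : ℝ) < period P k := by exact_mod_cast period_pos hP2 k
  rw [period_succ, sum_range_mul_eq, ← period_succ]
  have key : ∀ s ∈ Finset.range (period P k ^ 4), ∑ i ∈ Finset.range (period P k),
      |freq (blocks P W Z (k + 1)) w (period P (k + 1)) (s * period P k + i) -
        freq (blocks P W Z k) w (period P k) ((s * period P k + i) % period P k)| ≤
      w.length + 1 := by
    intro s hs
    rw [Finset.mem_range] at hs
    calc _ ≤ ∑ i ∈ Finset.range (period P k),
          (2 * defect A P k + if period P k < i + w.length then (1 : ℝ) else 0) := by
          refine Finset.sum_le_sum fun i hi => ?_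
          rw [Finset.mem_range] at hi
          rw [Nat.mul_add_mod_self_right, Nat.mod_eq_of_lt hi]
          split_ifs with h
          · have h1 := freq_nonneg (blocks P W Z (k + 1)) w (period P (k + 1)) (s * period P k + i)
            have h2 := freq_le_one (blocks P W Z (k + 1)) w (period P (k + 1)) (s * period P k + i)
            have h3 := freq_nonneg (blocks P W Z k) w (period P k) i
            have h4 := freq_le_one (blocks P W Z k) w (period P k) i
            have := (defect_pos (A := A) hP2 k).le
            rw [abs_le]; constructor <;> linarith
          · rw [add_zero]
            exact abs_freq_succ_sub_le hP hZ w k hs (not_lt.1 h)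
      -- Per sub-block, the last positions, where `w` overruns the boundary, cost at most
      -- `w.length`; the change of law costs at most `1 / 4` altogether.
      _ ≤ period P k * (2 * defect A P k) + w.length := by
          rw [Finset.sum_add_distrib]
          gcongr
          · simp
          · exact sum_range_ite_lt_add_le _ _
      _ ≤ w.length + 1 := by
          have := defect_le (A := A) hP2 k
          rw [le_div_iff₀ (by positivity)] at this
          nlinarith
  refine (Finset.sum_le_sum key).trans_eq ?_
  rw [Finset.sum_const, Finset.card_range, nsmul_eq_mul, Nat.cast_pow]

/-- The step from `m` to `m + 1` has relative cost `(w.length + 1) / period P m`. As periods at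
least double, this is dominated by a difference of consecutive values of `2 / period`, and the bound
telescopes. -/
theorem sum_abs_freq_sub_le (hP : 4 * (60 + Fintype.card A) ≤ P)
    (hZ : ∀ c i, |Z c i| ≤ 1) (w : List A) (k m : ℕ) (hkm : k ≤ m) :
    ∑ j ∈ Finset.range (period P m),
      |freq (blocks P W Z m) w (period P m) j -
        freq (blocks P W Z k) w (period P k) (j % period P k)| ≤
      period P m * ((w.length + 1) * (2 / period P k - 2 / period P m)) := by
  have hP2 : 2 ≤ P := by omega
  induction m, hkm using Nat.le_induction with
  | base =>
    rw [Finset.sum_eq_zero]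
    · simp
    · intro j hj
      rw [Nat.mod_eq_of_lt (Finset.mem_range.1 hj), sub_self, abs_zero]
  | succ m hkm ih =>
    have hp : (0 : ℝ) < period P m := by exact_mod_cast period_pos hP2 m
    have hpk : (0 : ℝ) < period P k := by exact_mod_cast period_pos hP2 k
    have hq : (2 : ℝ) * period P m ≤ period P (m + 1) := by
      exact_mod_cast two_mul_period_le hP2 m
    have hs : (period P (m + 1) : ℝ) = (period P m : ℝ) ^ 4 * period P m := by
      rw [period_succ]; push_cast; ring
    have h1 := sum_abs_freq_succ_sub_le (W := W) hP hZ w m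
    have h2 : ∑ j ∈ Finset.range (period P (m + 1)),
        |freq (blocks P W Z m) w (period P m) (j % period P m) -
          freq (blocks P W Z k) w (period P k) (j % period P k)| =
        (period P m : ℝ) ^ 4 * ∑ j ∈ Finset.range (period P m),
          |freq (blocks P W Z m) w (period P m) j -
            freq (blocks P W Z k) w (period P k) (j % period P k)| := by
      rw [period_succ, sum_range_mul_eq, Finset.sum_congr rfl (g := fun _ =>
        ∑ j ∈ Finset.range (period P m), |freq (blocks P W Z m) w (period P m) j -
            freq (blocks P W Z k) w (period P k) (j % period P k)|)]
      · simp
      · intro s _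
        refine Finset.sum_congr rfl fun j hj => ?_
        obtain ⟨d, hd⟩ := period_dvd P hkm
        rw [Nat.mul_add_mod_self_right, Nat.mod_eq_of_lt (Finset.mem_range.1 hj)]
        congr 3
        rw [hd, ← mul_assoc, mul_comm s, mul_assoc, Nat.mul_add_mod]
    calc _ ≤ ∑ j ∈ Finset.range (period P (m + 1)),
          (|freq (blocks P W Z (m + 1)) w (period P (m + 1)) j -
            freq (blocks P W Z m) w (period P m) (j % period P m)| +
          |freq (blocks P W Z m) w (period P m) (j % period P m) -
            freq (blocks P W Z k) w (period P k) (j % period P k)|) :=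
          Finset.sum_le_sum fun j _ => abs_sub_le _ _ _
      _ ≤ (period P m : ℝ) ^ 4 * (w.length + 1) + (period P m : ℝ) ^ 4 *
          (period P m * ((w.length + 1) * (2 / period P k - 2 / period P m))) := by
          rw [Finset.sum_add_distrib, h2]
          gcongr
      _ = period P (m + 1) * ((w.length + 1) * (2 / period P k - 1 / period P m)) := by
          rw [hs]; field_simp; ring
      _ ≤ _ := by
          have : (2 : ℝ) / period P (m + 1) ≤ 1 / period P m := by
            rw [div_le_div_iff₀ (by linarith) hp]
            linarith
          gcongr

/-- Each level loses at most `2 * defect` on average; since `defect` at least halves, the term `4 *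
defect A P m` carries the induction. -/
theorem le_sum_freq (hP : 4 * (60 + Fintype.card A) ≤ P) (hZ : ∀ c i, |Z c i| ≤ 1) (w : List A)
    (k m : ℕ) (hkm : k ≤ m) :
    period P m * ((∑ j ∈ Finset.range (period P k), freq (blocks P W Z k) w (period P k) j) /
      period P k - 4 * defect A P k + 4 * defect A P m) ≤
      ∑ j ∈ Finset.range (period P m), freq (blocks P W Z m) w (period P m) j := by
  have hP2 : 2 ≤ P := by omega
  induction m, hkm using Nat.le_induction with
  | base =>
    have hp : (0 : ℝ) < period P k := by exact_mod_cast period_pos hP2 k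
    apply le_of_eq
    field_simp
    ring
  | succ m hkm ih =>
    set e := (∑ j ∈ Finset.range (period P k), freq (blocks P W Z k) w (period P k) j) / period P k
    have hp : (0 : ℝ) < period P m := by exact_mod_cast period_pos hP2 m
    have hs : (period P (m + 1) : ℝ) = (period P m : ℝ) ^ 4 * period P m := by
      rw [period_succ]; push_cast; ring
    have hd := two_mul_defect_succ_le (A := A) hP2 m
    calc _ ≤ (period P m : ℝ) ^ 4 * (period P m * (e - 4 * defect A P k + 4 * defect A P m) -
          period P m * (2 * defect A P m)) := by
          rw [hs, ← mul_sub, ← mul_assoc]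
          gcongr
          linarith
      _ ≤ (period P m : ℝ) ^ 4 * (∑ j ∈ Finset.range (period P m),
          (freq (blocks P W Z m) w (period P m) j - 2 * defect A P m)) := by
          rw [Finset.sum_sub_distrib]
          gcongr
          simp
      _ = ∑ s ∈ Finset.range (period P m ^ 4), ∑ j ∈ Finset.range (period P m),
          (freq (blocks P W Z m) w (period P m) j - 2 * defect A P m) := by
          rw [Finset.sum_const, Finset.card_range, nsmul_eq_mul, Nat.cast_pow]
      _ ≤ ∑ s ∈ Finset.range (period P m ^ 4), ∑ j ∈ Finset.range (period P m),
          freq (blocks P W Z (m + 1)) w (period P (m + 1)) (s * period P m + j) :=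
          Finset.sum_le_sum fun s hs => Finset.sum_le_sum fun j _ =>
            freq_sub_le_freq_succ hP hZ w m (Finset.mem_range.1 hs) j
      _ = _ := by rw [← sum_range_mul_eq, ← period_succ]

end BlockShift

/-! ### The subshift, and weighted word counts along its points. -/

namespace BlockShift

variable {A : Type*} [Inhabited A] [Fintype A]

/-- The sequences all of whose prefixes occur in blocks of arbitrarily high level. -/
def blockShift (P : ℕ) (W : ℕ → List A) (Z : Bool → ℕ → ℝ) : Set (ℕ → A) :=
  {x | ∀ n k, ∃ m ≥ k, ∃ b ∈ blocks P W Z m, ∃ t, t + n ≤ period P m ∧ ∀ i < n, x i = b (t + i)}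

variable {P : ℕ} {W : ℕ → List A} {Z : Bool → ℕ → ℝ}

theorem shift_mem_blockShift {x : ℕ → A} (hx : x ∈ blockShift P W Z) (g : ℕ) :
    (fun i => x (g + i)) ∈ blockShift P W Z := by
  intro n k
  obtain ⟨m, hm, b, hb, t, ht, h⟩ := hx (g + n) k
  exact ⟨m, hm, b, hb, t + g, by omega, fun i hi => by
    rw [add_assoc]; exact h (g + i) (by omega)⟩

theorem exists_block_of_mem_blocks (hP : 2 ≤ P) {k m : ℕ} (hkm : k ≤ m) :
    ∀ {b : ℕ → A}, b ∈ blocks P W Z m → ∀ s, (s + 1) * period P k ≤ period P m →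
      ∃ b' ∈ blocks P W Z k, ∀ j < period P k, b (s * period P k + j) = b' j := by
  induction m, hkm using Nat.le_induction with
  | base =>
    intro b hb s hs
    have := period_pos hP k
    have hs0 : s = 0 := by
      by_contra h
      have : 2 * period P k ≤ (s + 1) * period P k := Nat.mul_le_mul_right _ (by omega)
      omega
    exact ⟨b, hb, fun j _ => by simp [hs0]⟩
  | succ m hkm ih =>
    intro b hb s hs
    obtain ⟨v, hv, -, rfl⟩ := (mem_blocks_succ P W Z).1 hb
    obtain ⟨d, hd⟩ := period_dvd P hkm
    have hk := period_pos hP k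
    have hd0 : 0 < d := by
      rcases Nat.eq_zero_or_pos d with h | h
      · have := period_pos hP m; simp [hd, h] at this
      · exact h
    have hsd : s / d < period P m ^ 4 := by
      rw [period_succ, hd, mul_comm (period P k) d, ← mul_assoc] at hs
      have := Nat.le_of_mul_le_mul_right hs hk
      rw [Nat.div_lt_iff_lt_mul hd0, hd]
      rw [mul_comm (period P k)]
      omega
    have hmod := Nat.mod_lt s hd0
    obtain ⟨b', hb', h⟩ := ih (hv ⟨s / d, hsd⟩) (s % d) (by
      rw [hd, mul_comm]; exact Nat.mul_le_mul_left _ hmod)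
    refine ⟨b', hb', fun j hj => ?_⟩
    rw [← h j hj, ← concat_apply v ⟨s / d, hsd⟩]
    · congr 1
      simp only
      rw [hd]
      conv_lhs => rw [← Nat.div_add_mod s d]
      ring
    · calc s % d * period P k + j < (s % d + 1) * period P k := by rw [Nat.succ_mul]; omega
        _ ≤ d * period P k := Nat.mul_le_mul_right _ hmod
        _ = period P m := by rw [hd, mul_comm]

/-- Any finite window of an element of `blockShift` is cut into blocks of level `k`. -/
theorem exists_alignment (hP : 2 ≤ P) {x : ℕ → A} (hx : x ∈ blockShift P W Z) (k n : ℕ) :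
    ∃ a < period P k, ∀ s, a + (s + 1) * period P k ≤ n →
      ∃ b ∈ blocks P W Z k, ∀ j < period P k, x (a + s * period P k + j) = b j := by
  obtain ⟨m, hm, b, hb, t, ht, h⟩ := hx n k
  have hp := period_pos hP k
  set p := period P k
  -- The window starts at position `t` of a large block; `a` is the distance to the next multiple of
  -- `p`. It may depend on `n`, so no parsing of the whole sequence is needed.
  obtain ⟨u, a, hap, hua⟩ : ∃ u a, a < p ∧ t + a = u * p := by
    rcases Nat.eq_zero_or_pos (t % p) with h0 | h0
    · exact ⟨t / p, 0, hp, by rw [add_zero, mul_comm]; exact (Nat.mul_div_cancel' (Nat.dvd_of_mod_eq_zero h0)).symm⟩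
    · refine ⟨t / p + 1, p - t % p, by omega, ?_⟩
      have h1 := Nat.div_add_mod t p
      have h2 := Nat.mod_lt t hp
      rw [Nat.succ_mul, mul_comm]
      omega
  refine ⟨a, hap, fun s hs => ?_⟩
  obtain ⟨b', hb', h'⟩ := exists_block_of_mem_blocks hP hm hb (u + s) (by
    calc (u + s + 1) * p = t + (a + (s + 1) * p) := by rw [← add_assoc, hua]; ring
      _ ≤ period P m := by omega)
  refine ⟨b', hb', fun j hj => ?_⟩
  rw [← h' j hj, h _ (by rw [Nat.succ_mul] at hs; omega)]
  congr 1
  rw [add_mul, ← hua]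
  ring

/-- The weighted number of occurrences of a word along a block is close to the one predicted by the
frequencies in the blocks of a lower level. -/
theorem abs_sum_block_le (hP : 4 * (60 + Fintype.card A) ≤ P) (hZ : ∀ c i, |Z c i| ≤ 1)
    {l k m : ℕ} (hlk : l ≤ k) (hkm : k ≤ m) (c : Bool) {b x : ℕ → A}
    (hb : b ∈ blocks P W Z (m + 1)) (hx : ∀ j < period P (m + 1), x j = b j) {i : ℕ}
    (hi : i < period P (m + 1) ^ 10) :
    |∑ j ∈ Finset.range (period P (m + 1)), (ind (W l) (fun t => x (j + t)) -
      freq (blocks P W Z k) (W l) (period P k) (j % period P k)) * Z c (i + j)| ≤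
      period P (m + 1) * (3 * ((W l).length + 1) / period P k) := by
  classical
  have hP2 : 2 ≤ P := by omega
  obtain ⟨p, hpdef⟩ : ∃ p, p = period P m := ⟨_, rfl⟩
  have hex := (mem_blocks_succ P W Z).1 hb
  rw [← hpdef] at hex
  obtain ⟨v, hv, hbal, rfl⟩ := hex
  set w := W l with hw
  have hp : (0 : ℝ) < p := by rw [hpdef]; exact_mod_cast period_pos hP2 m
  have hpk : (0 : ℝ) < period P k := by exact_mod_cast period_pos hP2 k
  have hs : (period P (m + 1) : ℝ) = (p : ℝ) ^ 4 * p := by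
    rw [period_succ, ← hpdef]; push_cast; ring
  have hbal' : |∑ s : Fin (p ^ 4), ∑ j ∈ Finset.range p,
      (occ w p (v s) j - freq (blocks P W Z m) w p j) * Z c (i + s * p + j)| ≤ (p : ℝ) ^ 4 := by
    have := hbal l (hlk.trans hkm) c i hi
    exact_mod_cast this
  have hD := sum_abs_freq_sub_le (W := W) hP hZ w k m hkm
  rw [← hpdef] at hD
  -- The deviation splits into the part controlled by balance and two errors: occurrences leaving a
  -- sub-block, and the drift of the frequencies.
  have h1 : ∑ j ∈ Finset.range (period P (m + 1)), (ind w (fun t => x (j + t)) -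
      freq (blocks P W Z k) w (period P k) (j % period P k)) * Z c (i + j) =
      ∑ s : Fin (p ^ 4), ∑ j ∈ Finset.range p,
        (occ w p (v s) j - freq (blocks P W Z m) w p j) * Z c (i + s * p + j) +
      ∑ s : Fin (p ^ 4), ∑ j ∈ Finset.range p,
        ((ind w (fun t => x (s * p + j + t)) - occ w p (v s) j) +
        (freq (blocks P W Z m) w p j - freq (blocks P W Z k) w (period P k) (j % period P k))) *
          Z c (i + s * p + j) := by
    rw [period_succ, ← hpdef, sum_range_mul_eq, ← Finset.sum_add_distrib, Finset.sum_range]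
    refine Finset.sum_congr rfl fun s _ => ?_
    rw [← Finset.sum_add_distrib]
    refine Finset.sum_congr rfl fun j hj => ?_
    obtain ⟨d, hd⟩ := period_dvd P hkm
    rw [← hpdef] at hd
    have : (s * p + j) % period P k = j % period P k := by
      have : s * p + j = period P k * (d * s) + j := by
        rw [mul_comm (s : ℕ) p]; nth_rewrite 1 [hd]; ring
      rw [this, Nat.mul_add_mod]
    rw [this, ← add_assoc]
    ring
  have h2 : ∀ s : Fin (p ^ 4), ∀ j ∈ Finset.range p,
      |((ind w (fun t => x (s * p + j + t)) - occ w p (v s) j) +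
        (freq (blocks P W Z m) w p j - freq (blocks P W Z k) w (period P k) (j % period P k))) *
          Z c (i + s * p + j)| ≤ (if p < j + w.length then (1 : ℝ) else 0) +
        |freq (blocks P W Z m) w p j - freq (blocks P W Z k) w (period P k) (j % period P k)| := by
    intro s j hj
    rw [Finset.mem_range] at hj
    rw [abs_mul]
    refine (mul_le_of_le_one_right (abs_nonneg _) (hZ _ _)).trans ((abs_add_le _ _).trans ?_)
    gcongr
    split_ifs with h
    · have h1 := occ_nonneg w p (v s) j
      have h2 := occ_le_one w p (v s) j
      have h3 := ind_nonneg w (fun t => x (s * p + j + t))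
      have h4 := ind_le_one w (fun t => x (s * p + j + t))
      rw [abs_le]; constructor <;> linarith
    · have : StartsWith w (fun t => x (s * p + j + t)) ↔ OccursIn w p (v s) j := by
        rw [OccursIn, and_iff_right (not_lt.1 h)]
        refine forall₂_congr fun t ht => ?_
        have hjt : j + t < p := by omega
        have hlt : s * p + j + t < period P (m + 1) := by
          have h1 : (s + 1) * p ≤ p ^ 4 * p := Nat.mul_le_mul_right p s.2
          rw [Nat.succ_mul] at h1
          rw [period_succ, ← hpdef]
          omega
        simp only
        rw [hx _ hlt, add_assoc, concat_apply v s hjt]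
      rw [ind, occ, if_congr this rfl rfl, sub_self, abs_zero]
  have h3 : |∑ s : Fin (p ^ 4), ∑ j ∈ Finset.range p,
        ((ind w (fun t => x (s * p + j + t)) - occ w p (v s) j) +
        (freq (blocks P W Z m) w p j - freq (blocks P W Z k) w (period P k) (j % period P k))) *
          Z c (i + s * p + j)| ≤ (p : ℝ) ^ 4 * (w.length +
        p * ((w.length + 1) * (2 / period P k - 2 / p))) := by
    refine (Finset.abs_sum_le_sum_abs _ _).trans ?_
    calc _ ≤ ∑ s : Fin (p ^ 4), ((w.length : ℝ) +
          p * ((w.length + 1) * (2 / period P k - 2 / p))) := by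
          refine Finset.sum_le_sum fun s _ => (Finset.abs_sum_le_sum_abs _ _).trans ?_
          refine (Finset.sum_le_sum (h2 s)).trans ?_
          rw [Finset.sum_add_distrib]
          exact add_le_add (sum_range_ite_lt_add_le _ _) hD
      _ = _ := by
          rw [Finset.sum_const, Finset.card_univ, Fintype.card_fin, nsmul_eq_mul, Nat.cast_pow]
  rw [h1]
  refine (abs_add_le _ _).trans ((add_le_add hbal' h3).trans ?_)
  have hr : (0 : ℝ) ≤ w.length := Nat.cast_nonneg _
  rw [hs]
  -- The term `-2 / p` saved in the drift bound pays for the balance and boundary errors `1 +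
  -- w.length`.
  have e1 : (p : ℝ) * (3 * (w.length + 1) / period P k) -
      (1 + (w.length + p * ((w.length + 1) * (2 / period P k - 2 / p)))) =
      (w.length + 1) * (p / period P k + 1) := by
    field_simp; ring
  have e2 : (0 : ℝ) ≤ (w.length + 1) * (p / period P k + 1) := by positivity
  have e3 : (0 : ℝ) ≤ (p : ℝ) ^ 4 := by positivity
  nlinarith [mul_nonneg e3 e2]

/-- Along every point of `blockShift`, weighted numbers of occurrences of a word are uniformly close
to those predicted by a periodic sequence of frequencies. -/
theorem exists_phase (hP : 4 * (60 + Fintype.card A) ≤ P) (hZ : ∀ c i, |Z c i| ≤ 1)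
    {l k : ℕ} (hlk : l ≤ k) (c : Bool) {x : ℕ → A} (hx : x ∈ blockShift P W Z) {n : ℕ}
    (hn : period P (k + 1) ^ 2 ≤ n) :
    ∃ a, |∑ j ∈ Finset.range n, (ind (W l) (fun t => x (j + t)) -
      freq (blocks P W Z k) (W l) (period P k) ((j + a) % period P k)) * Z c j| ≤
      5 * ((W l).length + 1) / period P k * n := by
  have hP2 : 2 ≤ P := by omega
  -- Since `period P (m + 1) ^ 10 = period P (m + 2) ^ 2`, these ranges leave no gap. In them `n` is
  -- long compared with the blocks, yet all starting positions below `n` were tested for balance.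
  obtain ⟨m, hkm, hmn, hnm⟩ : ∃ m ≥ k, period P (m + 1) ^ 2 ≤ n ∧ n < period P (m + 1) ^ 10 := by
    have hex : ∃ m, n < period P m ^ 2 :=
      ⟨n, (succ_le_period hP2 n).trans (Nat.le_self_pow (by norm_num) _)⟩
    classical
    have h1 := Nat.find_spec hex
    have h2 := fun {m} => Nat.find_min hex (m := m)
    set M := Nat.find hex
    have hM : k + 1 < M := by
      by_contra h
      have : period P M ^ 2 ≤ period P (k + 1) ^ 2 :=
        Nat.pow_le_pow_left ((period_strictMono hP2).monotone (not_lt.1 h)) 2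
      omega
    refine ⟨M - 2, by omega, ?_, ?_⟩
    · have := h2 (m := M - 2 + 1) (by omega)
      omega
    · have : period P (M - 2 + 1) ^ 10 = period P M ^ 2 := by
        obtain ⟨d, hd⟩ : ∃ d, M = d + 2 := ⟨M - 2, by omega⟩
        rw [hd, Nat.add_sub_cancel, period_succ P (d + 1)]
        ring
      omega
  have hp := period_pos hP2 (m + 1)
  have hpn : period P (m + 1) ≤ n := (Nat.le_self_pow (by norm_num) _).trans hmn
  obtain ⟨a, hap, hal⟩ := exists_alignment hP2 hx (m + 1) n
  set q := period P (m + 1) with hq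
  obtain ⟨d, hd⟩ := period_dvd P (show k ≤ m + 1 by omega)
  rw [← hq] at hd
  set M := (n - a) / q
  set ρ := (n - a) % q
  have hdm : q * M + ρ = n - a := Nat.div_add_mod _ _
  have hρ : ρ < q := Nat.mod_lt _ hp
  have hsplit : n = a + (M * q + ρ) := by rw [mul_comm]; omega
  -- This phase sends the block starts `a + s * q` to multiples of `q`, hence of `period P k`.
  refine ⟨q - a, ?_⟩
  set g : ℕ → ℝ := fun j => (ind (W l) (fun t => x (j + t)) -
      freq (blocks P W Z k) (W l) (period P k) ((j + (q - a)) % period P k)) * Z c j with hg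
  have hg1 : ∀ j, |g j| ≤ 1 := by
    intro j
    have h1 := freq_nonneg (blocks P W Z k) (W l) (period P k) ((j + (q - a)) % period P k)
    have h2 := freq_le_one (blocks P W Z k) (W l) (period P k) ((j + (q - a)) % period P k)
    have h3 := ind_nonneg (W l) (fun t => x (j + t))
    have h4 := ind_le_one (W l) (fun t => x (j + t))
    rw [hg, abs_mul]
    refine mul_le_one₀ ?_ (abs_nonneg _) (hZ _ _)
    rw [abs_le]; constructor <;> linarith
  have hpart : ∀ (u N : ℕ), |∑ j ∈ Finset.range N, g (u + j)| ≤ N := fun u N => by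
    refine (Finset.abs_sum_le_sum_abs _ _).trans ((Finset.sum_le_sum fun j _ => hg1 _).trans ?_)
    simp
  have hmid : |∑ j ∈ Finset.range (M * q), g (a + j)| ≤
      M * (q * (3 * ((W l).length + 1) / period P k)) := by
    rw [sum_range_mul_eq]
    refine (Finset.abs_sum_le_sum_abs _ _).trans ?_
    refine (Finset.sum_le_sum fun s hs => ?_).trans_eq
      (b := ∑ _s ∈ Finset.range M, (q * (3 * (((W l).length : ℝ) + 1) / period P k))) ?_
    · rw [Finset.mem_range] at hs
      have hsM : (s + 1) * q ≤ M * q := Nat.mul_le_mul_right q hs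
      obtain ⟨b, hb, hbx⟩ := hal s (by omega)
      have := abs_sum_block_le hP hZ hlk hkm c hb hbx (i := a + s * q) (by
        rw [Nat.succ_mul] at hsM
        change a + s * q < q ^ 10
        omega)
      refine le_of_eq_of_le ?_ this
      congr 1
      refine Finset.sum_congr rfl fun j _ => ?_
      have : (a + (s * q + j) + (q - a)) % period P k = j % period P k := by
        have : a + (s * q + j) + (q - a) = period P k * (d * (s + 1)) + j := by
          rw [← mul_assoc, ← hd, mul_add]
          have : s * q = q * s := mul_comm _ _
          omega
        rw [this, Nat.mul_add_mod]
      simp only [hg, this]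
      simp only [add_assoc]
    · rw [Finset.sum_const, Finset.card_range, nsmul_eq_mul]
  have hfinal : |∑ j ∈ Finset.range n, g j| ≤
      a + (M * (q * (3 * ((W l).length + 1) / period P k)) + ρ) := by
    have h0 : ∑ j ∈ Finset.range n, g j = ∑ j ∈ Finset.range a, g (0 + j) +
        (∑ j ∈ Finset.range (M * q), g (a + j) +
          ∑ j ∈ Finset.range ρ, g (a + M * q + j)) := by
      conv_lhs => rw [hsplit]
      rw [Finset.sum_range_add, Finset.sum_range_add]
      simp only [zero_add, add_assoc]
    rw [h0]
    refine (abs_add_le _ _).trans (add_le_add (hpart _ _) ?_)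
    exact (abs_add_le _ _).trans (add_le_add hmid (hpart _ _))
  refine hfinal.trans ?_
  have hk0 : (0 : ℝ) < period P k := by exact_mod_cast period_pos hP2 k
  have hq0 : (0 : ℝ) < q := by exact_mod_cast hp
  have hkq : (period P k : ℝ) ≤ q := by
    exact_mod_cast (period_strictMono hP2).monotone (show k ≤ m + 1 by omega)
  have hqn : (q : ℝ) ≤ n / period P k := by
    rw [le_div_iff₀ hk0]
    calc (q : ℝ) * period P k ≤ q * q := by gcongr
      _ ≤ n := by
        have : (q : ℝ) ^ 2 ≤ n := by exact_mod_cast hmn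
        nlinarith
  have ha' : (a : ℝ) ≤ q := by exact_mod_cast hap.le
  have hρ' : (ρ : ℝ) ≤ q := by exact_mod_cast hρ.le
  have hMq : (M : ℝ) * q ≤ n := by
    have : M * q ≤ n := by omega
    exact_mod_cast this
  have hr : (0 : ℝ) ≤ (W l).length := Nat.cast_nonneg _
  calc (a : ℝ) + (M * (q * (3 * ((W l).length + 1) / period P k)) + ρ)
      ≤ n / period P k + (n * (3 * ((W l).length + 1) / period P k) + n / period P k) := by
        rw [← mul_assoc]
        gcongr
        · linarith
        · linarith
    _ = (3 * ((W l).length + 1) + 2) / period P k * n := by ring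
    _ ≤ _ := by
        gcongr
        linarith

/-- A word occurring in some block occurs in every point of `blockShift`. -/
theorem exists_startsWith (hP : 4 * (60 + Fintype.card A) ≤ P) (hZ : ∀ c i, |Z c i| ≤ 1)
    (hZ1 : ∀ i, Z true i = 1) (hW : Function.Surjective W) {w : List A} {m j : ℕ} {b : ℕ → A}
    (hb : b ∈ blocks P W Z m) (hj : OccursIn w (period P m) b j) (hw : w ≠ [])
    {x : ℕ → A} (hx : x ∈ blockShift P W Z) : ∃ i, StartsWith w fun t => x (i + t) := by
  classical
  have hP2 : 2 ≤ P := by omega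
  obtain ⟨l, rfl⟩ := hW w
  have hm0 : (0 : ℝ) < period P m := by exact_mod_cast period_pos hP2 m
  have hA0 : (0 : ℝ) < Fintype.card A := by exact_mod_cast (Fintype.card_pos : 0 < Fintype.card A)
  -- One block among at most `|A| ^ p` contains the word, so its mean frequency per position is at
  -- least `2 * γ`; the later losses sum to at most `4 * defect A P m = γ`.
  set γ : ℝ := 1 / (2 * period P m * (Fintype.card A : ℝ) ^ period P m) with hγ
  have hγ0 : 0 < γ := by positivity
  have hB0 : (0 : ℝ) < (blocks P W Z m).card := by
    exact_mod_cast Finset.card_pos.2 ⟨b, hb⟩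
  have hjlt : j < period P m := by
    have := List.length_pos_iff.2 hw
    have := hj.1
    omega
  have h1 : 1 / (Fintype.card A : ℝ) ^ period P m ≤
      ∑ i ∈ Finset.range (period P m), freq (blocks P W Z m) (W l) (period P m) i := by
    refine le_trans ?_ (Finset.single_le_sum
      (f := fun i => freq (blocks P W Z m) (W l) (period P m) i)
      (fun i _ => freq_nonneg ..) (Finset.mem_range.2 hjlt))
    have h2 : (1 : ℝ) ≤ ∑ b ∈ blocks P W Z m, occ (W l) (period P m) b j := by
      refine le_trans ?_ (Finset.single_le_sum
        (f := fun b => occ (W l) (period P m) b j) (fun i _ => occ_nonneg ..) hb)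
      simp [occ, hj]
    have h3 : ((blocks P W Z m).card : ℝ) ≤ (Fintype.card A : ℝ) ^ period P m := by
      exact_mod_cast card_blocks_le hP2 m
    exact div_le_div₀ (by linarith) h2 hB0 h3
  have hlow : ∀ K ≥ m, period P K * γ ≤
      ∑ i ∈ Finset.range (period P K), freq (blocks P W Z K) (W l) (period P K) i := by
    intro K hK
    refine le_trans ?_ (le_sum_freq hP hZ (W l) m K hK)
    have hd := (defect_pos (A := A) hP2 K).le
    have h4 : 2 * γ ≤ (∑ i ∈ Finset.range (period P m),
        freq (blocks P W Z m) (W l) (period P m) i) / period P m := by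
      rw [le_div_iff₀ hm0]
      refine le_trans (le_of_eq ?_) h1
      rw [hγ]; field_simp
    have h5 : 4 * defect A P m = γ := by
      rw [hγ, defect]; field_simp; norm_num
    gcongr
    linarith
  obtain ⟨K, hK⟩ : ∃ K, K ≥ m ∧ K ≥ l ∧ 1 / γ < (period P K : ℝ) := by
    obtain ⟨K, hK⟩ := exists_nat_gt (1 / γ)
    refine ⟨max m (max l K), le_max_left _ _, (le_max_left _ _).trans (le_max_right _ _), ?_⟩
    refine hK.trans_le ?_
    exact_mod_cast ((le_max_right _ _).trans (le_max_right m _)).trans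
      ((Nat.le_succ _).trans (succ_le_period hP2 _))
  obtain ⟨hKm, hKl, hKγ⟩ := hK
  have hK0 : (0 : ℝ) < period P K := by exact_mod_cast period_pos hP2 K
  obtain ⟨a, ha, hal⟩ := exists_alignment hP2 hx (K + 1) (2 * period P (K + 1))
  obtain ⟨b', hb', hbx⟩ := hal 0 (by omega)
  obtain ⟨v, hv, hbal, rfl⟩ := (mem_blocks_succ P W Z).1 hb'
  -- With weight `1`, the actual count is at least the expected one, which exceeds `period P K ^ 4`,
  -- minus the tolerance `period P K ^ 4`; so it is positive.
  have hsum := (abs_le.1 (hbal l hKl true 0 (by have := period_pos hP2 (K + 1); positivity))).1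
  have hpos : 0 < ∑ s : Fin (period P K ^ 4), ∑ i ∈ Finset.range (period P K),
      occ (W l) (period P K) (v s) i := by
    simp only [hZ1, mul_one, Finset.sum_sub_distrib, Finset.sum_const, Finset.card_univ,
      Fintype.card_fin, nsmul_eq_mul] at hsum
    push_cast at hsum
    have h6 := hlow K hKm
    have h7 : 1 < period P K * γ := by rwa [div_lt_iff₀ hγ0] at hKγ
    have h8 : (0 : ℝ) < (period P K : ℝ) ^ 4 := by positivity
    nlinarith [mul_lt_mul_of_pos_left (h7.trans_le h6) h8]
  obtain ⟨s, -, hs⟩ := Finset.exists_ne_zero_of_sum_ne_zero hpos.ne'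
  obtain ⟨i, hi, hsi⟩ := Finset.exists_ne_zero_of_sum_ne_zero hs
  have hocc : OccursIn (W l) (period P K) (v s) i := by
    by_contra h
    exact hsi (if_neg h)
  have hocc' := hocc.concat
  rw [← period_succ] at hocc'
  refine ⟨a + (s * period P K + i), fun t ht => ?_⟩
  have := hocc'.2 t ht
  simp only at this ⊢
  rw [← this, ← hbx _ (by have := hocc'.1; omega)]
  congr 1
  omega

variable [TopologicalSpace A] [DiscreteTopology A]

theorem isClosed_blockShift : IsClosed (blockShift P W Z) := by
  rw [← isOpen_compl_iff, isOpen_iff_mem_nhds]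
  intro x hx
  simp only [blockShift, Set.mem_compl_iff, Set.mem_ofPred_eq, not_forall] at hx
  obtain ⟨n, k, h⟩ := hx
  refine mem_of_superset ((isOpen_cylinder (Finset.range n) x).mem_nhds fun i _ => rfl) ?_
  intro x' hx' hmem
  obtain ⟨m, hm, b, hb, t, ht, hb'⟩ := hmem n k
  exact h ⟨m, hm, b, hb, t, ht, fun i hi => by
    rw [← hx' i (Finset.mem_range.2 hi)]; exact hb' i hi⟩

/-- By compactness, a sequence of blocks of increasing level has a cluster point, whose prefixes are
prefixes of arbitrarily high blocks. -/
theorem blockShift_nonempty (hP : 4 * (60 + Fintype.card A) ≤ P) (hZ : ∀ c i, |Z c i| ≤ 1) :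
    (blockShift P W Z).Nonempty := by
  have hP2 : 2 ≤ P := by omega
  choose b hb using fun k => blocks_nonempty (W := W) hP hZ k
  obtain ⟨x, hx⟩ := exists_clusterPt_of_compactSpace (map b atTop)
  refine ⟨x, fun n k => ?_⟩
  have h1 := (mapClusterPt_iff_frequently.1 hx) _
    ((isOpen_cylinder (Finset.range n) x).mem_nhds fun i _ => rfl)
  obtain ⟨m, hm, h⟩ := (frequently_atTop.1 h1) (max n k)
  refine ⟨m, (le_max_right _ _).trans hm, b m, hb m, 0, ?_, fun i hi => ?_⟩
  · have := succ_le_period hP2 m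
    have := (le_max_left n k).trans hm
    omega
  · rw [zero_add]
    exact (h i (Finset.mem_range.2 hi)).symm

end BlockShift

/-! ### Invariant measures and unique ergodicity from uniform Birkhoff averages. -/

section UniqueErgodicity

/-- A limit along one fixed ultrafilter is linear and monotone in the sequence, so limits of
Birkhoff averages form a positive functional, to which Riesz–Markov applies. -/
theorem exists_tendsto_hyperfilter {u : ℕ → ℝ} {C : ℝ} (hu : ∀ n, |u n| ≤ C) :
    ∃ L, Tendsto u (hyperfilter ℕ : Filter ℕ) (𝓝 L) := by
  obtain ⟨L, -, hL⟩ := (isCompact_Icc (a := -C) (b := C)).ultrafilter_le_nhds'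
    ((hyperfilter ℕ).map u) (Filter.mem_map.2 <| Filter.univ_mem' fun n => abs_le.1 (hu n))
  exact ⟨L, hL⟩

variable {X : Type*} [TopologicalSpace X]

theorem exists_forall_abs_le [CompactSpace X] (f : C(X, ℝ)) : ∃ C, ∀ x, |f x| ≤ C := by
  refine ⟨‖f‖, fun x => f.norm_coe_le_norm x⟩

theorem abs_birkhoff_average_le {T : X → X} {f : C(X, ℝ)} {C : ℝ} (hC : ∀ x, |f x| ≤ C)
    (x : X) (n : ℕ) : |(∑ i ∈ Finset.range (n + 1), f (T^[i] x)) / (n + 1 : ℝ)| ≤ C := by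
  rw [abs_div, abs_of_pos (by positivity : (0 : ℝ) < n + 1), div_le_iff₀ (by positivity)]
  refine (Finset.abs_sum_le_sum_abs _ _).trans ((Finset.sum_le_sum fun i _ => hC _).trans ?_)
  simp; linarith

variable [CompactSpace X] [MeasurableSpace X] [BorelSpace X]

theorem integral_birkhoff_sum {T : X → X} {μ : Measure X} [IsFiniteMeasure μ]
    (hT : MeasurePreserving T μ μ) (hTc : Continuous T) (f : C(X, ℝ)) (n : ℕ) :
    ∫ x, ∑ i ∈ Finset.range n, f (T^[i] x) ∂μ = n * ∫ x, f x ∂μ := by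
  rw [integral_finsetSum]
  · have : ∀ i ∈ Finset.range n, ∫ x, f (T^[i] x) ∂μ = ∫ x, f x ∂μ := by
      intro i _
      have h := hT.iterate i
      conv_rhs => rw [← h.map_eq]
      rw [integral_map h.measurable.aemeasurable f.continuous.aestronglyMeasurable]
    rw [Finset.sum_congr rfl this, Finset.sum_const, Finset.card_range, nsmul_eq_mul]
  · intro i _
    exact (f.continuous.comp (hTc.iterate i)).integrable_of_hasCompactSupport
      (HasCompactSupport.of_compactSpace _)

variable [T2Space X] [HasOuterApproxClosed X]

/-- The Krylov–Bogoliubov theorem. -/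
theorem exists_invariant_probability_measure [Nonempty X] {T : X → X} (hT : Continuous T) :
    ∃ μ : Measure X, IsProbabilityMeasure μ ∧ MeasurePreserving T μ μ := by
  obtain ⟨x₀⟩ := ‹Nonempty X›
  let avg (f : C(X, ℝ)) (n : ℕ) : ℝ := (∑ i ∈ Finset.range (n + 1), f (T^[i] x₀)) / (n + 1 : ℝ)
  have hex : ∀ f : C(X, ℝ), ∃ L, Tendsto (avg f) (hyperfilter ℕ : Filter ℕ) (𝓝 L) := by
    intro f
    obtain ⟨C, hC⟩ := exists_forall_abs_le f
    exact exists_tendsto_hyperfilter (abs_birkhoff_average_le hC x₀)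
  choose L hL using hex
  have hadd : ∀ f g, L (f + g) = L f + L g := fun f g =>
    tendsto_nhds_unique (hL (f + g)) <| ((hL f).add (hL g)).congr fun n => by
      simp only [avg, ContinuousMap.add_apply, Finset.sum_add_distrib, add_div]
  have hsmul : ∀ (c : ℝ) f, L (c • f) = c * L f := fun c f =>
    tendsto_nhds_unique (hL (c • f)) <| ((hL f).const_mul c).congr fun n => by
      simp only [avg, ContinuousMap.smul_apply, smul_eq_mul, ← Finset.mul_sum, mul_div_assoc]
  have hmono : ∀ f g, (∀ x, f x ≤ g x) → L f ≤ L g := fun f g h =>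
    le_of_tendsto_of_tendsto' (hL f) (hL g) fun n => by
      simp only [avg]
      gcongr
      exact h _
  have hone : L 1 = 1 := tendsto_nhds_unique (hL 1) <| tendsto_const_nhds.congr fun n => by
    have : (n + 1 : ℝ) ≠ 0 := by positivity
    simp [avg, this]
  have hinv : ∀ f : C(X, ℝ), L (f.comp ⟨T, hT⟩) = L f := by
    intro f
    obtain ⟨C, hC⟩ := exists_forall_abs_le f
    have hdiff : Tendsto (fun n : ℕ => avg (f.comp ⟨T, hT⟩) n - avg f n)
        (hyperfilter ℕ : Filter ℕ) (𝓝 0) := by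
      refine Tendsto.mono_left ?_ (Nat.hyperfilter_le_atTop)
      refine squeeze_zero_norm (a := fun n : ℕ => 2 * C * (1 / ((n : ℝ) + 1))) (fun n => ?_) ?_
      · have h1 : avg (f.comp ⟨T, hT⟩) n - avg f n =
            (f (T^[n + 1] x₀) - f x₀) / (n + 1 : ℝ) := by
          simp only [avg, ContinuousMap.comp_apply, ContinuousMap.coe_mk]
          rw [← sub_div]
          congr 1
          have h2 := Finset.sum_range_succ' (fun i => f (T^[i] x₀)) (n + 1)
          have h3 := Finset.sum_range_succ (fun i => f (T^[i] x₀)) (n + 1)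
          simp only [Function.iterate_succ_apply', Function.iterate_zero, id] at h2 h3 ⊢
          linarith
        rw [h1, Real.norm_eq_abs, abs_div, abs_of_pos (by positivity : (0 : ℝ) < n + 1),
          mul_one_div]
        gcongr
        have h4 := abs_le.1 (hC (T^[n + 1] x₀))
        have h5 := abs_le.1 (hC x₀)
        rw [abs_le]; constructor <;> linarith
      · simpa using tendsto_one_div_add_atTop_nhds_zero_nat.const_mul (2 * C)
    have := tendsto_nhds_unique ((hL (f.comp ⟨T, hT⟩)).sub (hL f)) hdiff
    linarith
  let Λ : CompactlySupportedContinuousMap X ℝ →ₚ[ℝ] ℝ :=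
    { toFun := fun g => L g.toContinuousMap
      map_add' := fun g g' => hadd _ _
      map_smul' := fun c g => hsmul _ _
      monotone' := fun g g' h => hmono _ _ h }
  have hint : ∀ f : C(X, ℝ), ∫ x, f x ∂(RealRMK.rieszMeasure Λ) = L f := fun f =>
    RealRMK.integral_rieszMeasure Λ ⟨f, HasCompactSupport.of_compactSpace _⟩
  have hprob : IsProbabilityMeasure (RealRMK.rieszMeasure Λ) := by
    constructor
    have h1 := hint 1
    simp only [ContinuousMap.one_apply, integral_const, smul_eq_mul, mul_one, hone] at h1
    rw [measureReal_def] at h1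
    rwa [← ENNReal.toReal_eq_one_iff]
  refine ⟨RealRMK.rieszMeasure Λ, hprob, hT.measurable, ?_⟩
  have : IsProbabilityMeasure ((RealRMK.rieszMeasure Λ).map T) :=
    Measure.isProbabilityMeasure_map hT.measurable.aemeasurable
  refine ext_of_forall_integral_eq_of_IsFiniteMeasure fun f => ?_
  rw [integral_map hT.measurable.aemeasurable f.continuous.aestronglyMeasurable]
  exact (hint (f.toContinuousMap.comp ⟨T, hT⟩)).trans
    ((hinv f.toContinuousMap).trans (hint f.toContinuousMap).symm)

/-- If the Birkhoff averages of each continuous function become uniformly close to constants, the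
system is uniquely ergodic. -/
theorem isUniquelyErgodic_of_birkhoff_sums [Nonempty X] {T : X → X} (hT : Continuous T)
    (h : ∀ f : C(X, ℝ), ∀ δ > 0, ∃ n : ℕ, 1 ≤ n ∧ ∀ x x' : X,
      |∑ i ∈ Finset.range n, f (T^[i] x) - ∑ i ∈ Finset.range n, f (T^[i] x')| ≤ δ * n) :
    IsUniquelyErgodic T := by
  obtain ⟨μ, hμ, hμT⟩ := exists_invariant_probability_measure hT
  refine ⟨μ, ⟨hμ, hμT⟩, ?_⟩
  rintro ν ⟨hν, hνT⟩
  -- Integrating the estimate over `x` compares every invariant measure with the same orbit sum at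
  -- `x'`.
  have key : ∀ (f : C(X, ℝ)) (δ : ℝ) (n : ℕ) (x' : X), 1 ≤ n → (∀ x,
      |∑ i ∈ Finset.range n, f (T^[i] x) - ∑ i ∈ Finset.range n, f (T^[i] x')| ≤ δ * n) →
      ∀ (ρ : Measure X) [IsProbabilityMeasure ρ], MeasurePreserving T ρ ρ →
        |n * ∫ x, f x ∂ρ - ∑ i ∈ Finset.range n, f (T^[i] x')| ≤ δ * n := by
    intro f δ n x' hn hx ρ _ hρ
    rw [← integral_birkhoff_sum hρ hT f n]
    have hi : Integrable (fun x => ∑ i ∈ Finset.range n, f (T^[i] x)) ρ :=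
      (continuous_finsetSum _ fun i _ => f.continuous.comp (hT.iterate i)
        ).integrable_of_hasCompactSupport (HasCompactSupport.of_compactSpace _)
    have hs : ∫ x, ∑ i ∈ Finset.range n, f (T^[i] x) ∂ρ - ∑ i ∈ Finset.range n, f (T^[i] x') =
        ∫ x, (∑ i ∈ Finset.range n, f (T^[i] x) - ∑ i ∈ Finset.range n, f (T^[i] x')) ∂ρ := by
      rw [integral_sub hi (integrable_const _)]
      simp
    rw [hs]
    have := norm_integral_le_of_norm_le_const (μ := ρ)
      (f := fun x => ∑ i ∈ Finset.range n, f (T^[i] x) - ∑ i ∈ Finset.range n, f (T^[i] x'))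
      (C := δ * n) (Filter.Eventually.of_forall hx)
    simpa using this
  refine ext_of_forall_integral_eq_of_IsFiniteMeasure fun f => ?_
  refine eq_of_abs_sub_le_all fun ε hε => ?_
  obtain ⟨n, hn, hx⟩ := h f.toContinuousMap (ε / 2) (by positivity)
  obtain ⟨x'⟩ := ‹Nonempty X›
  have h1 := abs_le.1 (key _ _ n x' hn (fun x => hx x x') μ hμT)
  have h2 := abs_le.1 (key _ _ n x' hn (fun x => hx x x') ν hνT)
  have hn0 : (0 : ℝ) < n := by exact_mod_cast hn
  change |∫ x, f.toContinuousMap x ∂ν - ∫ x, f.toContinuousMap x ∂μ| ≤ ε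
  rw [← mul_le_mul_iff_right₀ hn0, ← abs_of_pos hn0, ← abs_mul, abs_of_pos hn0, abs_le]
  constructor <;> linarith

end UniqueErgodicity

/-! ### From words to continuous functions on a subshift. -/

section Subshifts

variable {A : Type*} [TopologicalSpace A]

theorem subshiftMap_iterate_val (S : Subshift A ℕ) (i : ℕ) (x : S.carrier) :
    ((subshiftMap S)^[i] x).1 = fun t => x.1 (i + t) := by
  induction i with
  | zero => simp
  | succ i ih =>
    rw [Function.iterate_succ_apply']
    change shift 1 ((subshiftMap S)^[i] x).1 = _
    rw [ih]
    funext t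
    rw [shift_apply, ← add_assoc]

theorem continuous_subshiftMap (S : Subshift A ℕ) : Continuous (subshiftMap S) :=
  Continuous.subtype_mk ((continuous_shift 1).comp continuous_subtype_val) _

variable [DiscreteTopology A]

theorem exists_forall_agree_mem {S : Subshift A ℕ} {x : S.carrier} {U : Set S.carrier}
    (hU : U ∈ 𝓝 x) : ∃ n, ∀ x' : S.carrier, (∀ i < n, x'.1 i = x.1 i) → x' ∈ U := by
  obtain ⟨V, hV, hVU⟩ := mem_nhds_subtype _ _ _ |>.1 hU
  obtain ⟨s, hs, hxs, hsV⟩ :=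
    (PiNat.isTopologicalBasis_cylinders (E := fun _ => A)).mem_nhds_iff.1 hV
  obtain ⟨z, n, rfl⟩ := hs
  refine ⟨n, fun x' hx' => hVU (hsV ?_)⟩
  intro i hi
  rw [hx' i hi]
  exact hxs i hi

/-- Uniform continuity in symbolic form: counterexamples agreeing on ever longer prefixes would
cluster at a point of discontinuity. -/
theorem exists_forall_agree_abs_sub_le [CompactSpace A] {S : Subshift A ℕ} (f : C(S.carrier, ℝ))
    {δ : ℝ} (hδ : 0 < δ) :
    ∃ r, ∀ x x' : S.carrier, (∀ i < r, x.1 i = x'.1 i) → |f x - f x'| ≤ δ := by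
  have : CompactSpace S.carrier := isCompact_iff_compactSpace.1 S.isClosed.isCompact
  by_contra! h
  choose x x' hxx' hf using h
  obtain ⟨z, hz⟩ := exists_clusterPt_of_compactSpace (map x atTop)
  obtain ⟨n, hn⟩ := exists_forall_agree_mem
    (f.continuous.continuousAt.preimage_mem_nhds (Metric.ball_mem_nhds (f z) (half_pos hδ)))
  have hcyl : {u : S.carrier | ∀ i < n, u.1 i = z.1 i} ∈ 𝓝 z := by
    have := (isOpen_cylinder (Finset.range n) z.1).mem_nhds (fun i _ => rfl)
    refine mem_of_superset (continuous_subtype_val.continuousAt.preimage_mem_nhds this) ?_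
    intro u hu i hi
    exact hu i (Finset.mem_range.2 hi)
  obtain ⟨m, hm, h⟩ := (frequently_atTop.1 (mapClusterPt_iff_frequently.1 hz _ hcyl)) n
  have h1 := hn (x m) h
  have h2 := hn (x' m) fun i hi => by rw [← hxx' m i (hi.trans_le hm)]; exact h i hi
  simp only [Set.mem_preimage, Metric.mem_ball, Real.dist_eq] at h1 h2
  have := hf m
  have h3 := abs_sub_le (f (x m)) (f z) (f (x' m))
  rw [abs_sub_comm (f z)] at h3
  linarith

open BlockShift

/-- Continuous functions on a subshift are uniformly approximated by combinations of indicators of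
words. -/
theorem exists_approx_by_words [Fintype A] {S : Subshift A ℕ} (f : C(S.carrier, ℝ))
    {δ : ℝ} (hδ : 0 < δ) :
    ∃ (r : ℕ) (c : (Fin r → A) → ℝ), ∀ x : S.carrier,
      |f x - ∑ u, c u * ind (List.ofFn u) x.1| ≤ δ := by
  classical
  obtain ⟨r, hr⟩ := exists_forall_agree_abs_sub_le f hδ
  refine ⟨r, fun u => if h : ∃ x : S.carrier, ∀ i : Fin r, x.1 i = u i then f h.choose else 0,
    fun x => ?_⟩
  rw [Finset.sum_eq_single (fun i : Fin r => x.1 i)]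
  · have hx : ∃ x' : S.carrier, ∀ i : Fin r, x'.1 i = x.1 i := ⟨x, fun _ => rfl⟩
    have h1 : StartsWith (List.ofFn fun i : Fin r => x.1 i) x.1 := fun i hi => by simp
    simp only
    rw [dif_pos hx, ind, if_pos h1, mul_one]
    exact hr _ _ fun i hi => (hx.choose_spec ⟨i, hi⟩).symm
  · intro u _ hu
    have : ¬ StartsWith (List.ofFn u) x.1 := by
      intro h
      refine hu (funext fun i => ?_)
      have := h i (by simp)
      simpa using this.symm
    rw [ind, if_neg this, mul_zero]
  · simp

/-- A uniform estimate for differences of weighted Birkhoff sums extends from indicators of words to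
continuous functions. -/
theorem birkhoff_estimate_of_words [Fintype A] {S : Subshift A ℕ} {z z' : ℕ → ℝ}
    (hz : ∀ j, |z j| ≤ 1) (hz' : ∀ j, |z' j| ≤ 1)
    (hw : ∀ (w : List A) (δ : ℝ), 0 < δ → ∃ n₀, ∀ n ≥ n₀, ∀ x x' : S.carrier,
      |∑ j ∈ Finset.range n, (ind w (fun t => x.1 (j + t)) * z j -
        ind w (fun t => x'.1 (j + t)) * z' j)| ≤ δ * n)
    (f : C(S.carrier, ℝ)) (δ : ℝ) (hδ : 0 < δ) : ∃ n₀, ∀ n ≥ n₀, ∀ x x' : S.carrier,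
      |∑ j ∈ Finset.range n, (f ((subshiftMap S)^[j] x) * z j -
        f ((subshiftMap S)^[j] x') * z' j)| ≤ δ * n := by
  obtain ⟨r, c, hc⟩ := exists_approx_by_words f (show 0 < δ / 3 by positivity)
  set K : ℝ := ∑ u, |c u| with hK
  have hK0 : 0 ≤ K := Finset.sum_nonneg fun _ _ => abs_nonneg _
  -- The approximation errors at `x` and `x'` use `2 * δ / 3`; the remaining `δ / 3` is shared among
  -- the words, with `K + 1` avoiding division by zero.
  choose n₀ hn₀ using fun u : Fin r → A => hw (List.ofFn u) (δ / (3 * (K + 1))) (by positivity)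
  refine ⟨Finset.univ.sup n₀, fun n hn x x' => ?_⟩
  set T := subshiftMap S
  set g : S.carrier → ℝ := fun x => ∑ u, c u * ind (List.ofFn u) x.1
  have h1 : ∑ j ∈ Finset.range n, (f (T^[j] x) * z j - f (T^[j] x') * z' j) =
      ∑ j ∈ Finset.range n, ((f (T^[j] x) - g (T^[j] x)) * z j -
        (f (T^[j] x') - g (T^[j] x')) * z' j) +
      ∑ u, c u * ∑ j ∈ Finset.range n, (ind (List.ofFn u) (fun t => x.1 (j + t)) * z j -
        ind (List.ofFn u) (fun t => x'.1 (j + t)) * z' j) := by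
    simp only [Finset.mul_sum]
    rw [Finset.sum_comm, ← Finset.sum_add_distrib]
    refine Finset.sum_congr rfl fun j _ => ?_
    simp only [g, T, subshiftMap_iterate_val]
    simp only [mul_sub, Finset.sum_sub_distrib, ← mul_assoc, ← Finset.sum_mul]
    ring
  have h2 : |∑ j ∈ Finset.range n, ((f (T^[j] x) - g (T^[j] x)) * z j -
        (f (T^[j] x') - g (T^[j] x')) * z' j)| ≤ n * (2 * (δ / 3)) := by
    refine (Finset.abs_sum_le_sum_abs _ _).trans ?_
    refine (Finset.sum_le_sum (g := fun _ => 2 * (δ / 3)) fun j _ => ?_).trans_eq (by simp)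
    refine (abs_sub _ _).trans ?_
    rw [abs_mul, abs_mul, two_mul]
    exact add_le_add
      ((mul_le_of_le_one_right (abs_nonneg _) (hz _)).trans (hc _))
      ((mul_le_of_le_one_right (abs_nonneg _) (hz' _)).trans (hc _))
  have h3 : |∑ u, c u * ∑ j ∈ Finset.range n, (ind (List.ofFn u) (fun t => x.1 (j + t)) * z j -
        ind (List.ofFn u) (fun t => x'.1 (j + t)) * z' j)| ≤ K * (δ / (3 * (K + 1)) * n) := by
    refine (Finset.abs_sum_le_sum_abs _ _).trans ?_
    rw [hK, Finset.sum_mul]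
    refine Finset.sum_le_sum fun u _ => ?_
    rw [abs_mul]
    gcongr
    exact hn₀ u n ((Finset.le_sup (Finset.mem_univ u)).trans hn) x x'
  rw [h1]
  refine (abs_add_le _ _).trans ((add_le_add h2 h3).trans ?_)
  have h4 : K * (δ / (3 * (K + 1)) * n) ≤ δ / 3 * n := by
    have : K * (δ / (3 * (K + 1))) ≤ δ / 3 := by
      rw [mul_div_assoc', div_le_div_iff₀ (by positivity) (by positivity)]
      nlinarith
    rw [← mul_assoc]
    gcongr
  linarith

end Subshifts

/-! ### Minimality, unique ergodicity and absence of correlation. -/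

namespace BlockShift

theorem abs_sum_shift_sub_sum_le {G : ℕ → ℝ} (h0 : ∀ j, 0 ≤ G j) (h1 : ∀ j, G j ≤ 1) (a n : ℕ) :
    |∑ j ∈ Finset.range n, G (a + j) - ∑ j ∈ Finset.range n, G j| ≤ a := by
  have e1 := Finset.sum_range_add G a n
  have e2 := Finset.sum_range_add G n a
  rw [add_comm n a] at e2
  have b1 : 0 ≤ ∑ j ∈ Finset.range a, G j := Finset.sum_nonneg fun _ _ => h0 _
  have b2 : 0 ≤ ∑ j ∈ Finset.range a, G (n + j) := Finset.sum_nonneg fun _ _ => h0 _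
  have b3 : ∑ j ∈ Finset.range a, G j ≤ a :=
    (Finset.sum_le_sum fun _ _ => h1 _).trans_eq (by simp)
  have b4 : ∑ j ∈ Finset.range a, G (n + j) ≤ a :=
    (Finset.sum_le_sum fun _ _ => h1 _).trans_eq (by simp)
  rw [abs_le]; constructor <;> linarith

theorem abs_sum_periodic_sub_le {F : ℕ → ℝ} (h0 : ∀ j, 0 ≤ F j) (h1 : ∀ j, F j ≤ 1) {p : ℕ}
    (hp : 0 < p) (a n : ℕ) :
    |∑ j ∈ Finset.range n, F ((j + a) % p) - ∑ j ∈ Finset.range n, F (j % p)| ≤ p := by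
  have h := abs_sum_shift_sub_sum_le (G := fun j => F (j % p)) (fun _ => h0 _) (fun _ => h1 _)
    (a % p) n
  have h2 : ((a % p : ℕ) : ℝ) ≤ p := by exact_mod_cast (Nat.mod_lt a hp).le
  refine le_of_eq_of_le ?_ (h.trans h2)
  congr 2
  refine Finset.sum_congr rfl fun j _ => ?_
  rw [Nat.mod_add_mod, add_comm]

/-- Weighted sums of periodic sequences are small if the weights have zero average along arithmetic
progressions. -/
theorem exists_abs_sum_periodic_mul_le {z : ℕ → ℝ} (hz : ∀ j, |z j| ≤ 1)
    (hap : ∀ p t : ℕ, 1 ≤ p → ∀ δ > 0, ∃ M₀, ∀ M ≥ M₀,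
      |∑ s ∈ Finset.range M, z (s * p + t)| ≤ δ * M) {p : ℕ} (hp : 1 ≤ p) {δ : ℝ} (hδ : 0 < δ) :
    ∃ n₀, ∀ n ≥ n₀, ∀ F : ℕ → ℝ, (∀ j, |F j| ≤ 1) → ∀ a,
      |∑ j ∈ Finset.range n, F ((j + a) % p) * z j| ≤ δ * n := by
  -- One threshold per residue class, fixed before `F` and `a`, makes the estimate uniform in the
  -- phase.
  choose M₀ hM₀ using fun t => hap p t hp (δ / 2) (by positivity)
  obtain ⟨n₁, hn₁⟩ := exists_nat_gt (2 * p / δ)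
  refine ⟨max n₁ (p * (Finset.range p).sup M₀), fun n hn F hF a => ?_⟩
  set M := n / p
  have hsplit : n = M * p + n % p := by rw [mul_comm]; exact (Nat.div_add_mod n p).symm
  have hmod : n % p < p := Nat.mod_lt n hp
  have hp0 : (0 : ℝ) < p := by exact_mod_cast hp
  have hMn : (M : ℝ) * p ≤ n := by exact_mod_cast Nat.div_mul_le_self n p
  have hnM : ∀ t ∈ Finset.range p, M₀ t ≤ M := fun t ht => by
    refine (Finset.le_sup (f := M₀) ht).trans ?_
    rw [Nat.le_div_iff_mul_le hp, mul_comm]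
    exact (le_max_right _ _).trans hn
  have hpn : (p : ℝ) ≤ δ / 2 * n := by
    have : (n₁ : ℝ) ≤ n := by exact_mod_cast (le_max_left _ _).trans hn
    have h2 := hn₁.trans_le this
    rw [div_lt_iff₀ hδ] at h2
    linarith
  have h1 : |∑ j ∈ Finset.range (M * p), F ((j + a) % p) * z j| ≤ p * (δ / 2 * M) := by
    rw [sum_range_mul_eq, Finset.sum_comm]
    refine (Finset.abs_sum_le_sum_abs _ _).trans ?_
    refine (Finset.sum_le_sum (g := fun _ => δ / 2 * M) fun t ht => ?_).trans_eq (by simp)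
    have : ∀ s ∈ Finset.range M, F ((s * p + t + a) % p) * z (s * p + t) =
        F ((t + a) % p) * z (s * p + t) := fun s _ => by
      rw [add_assoc, mul_comm s, Nat.mul_add_mod]
    rw [Finset.sum_congr rfl this, ← Finset.mul_sum, abs_mul]
    exact (mul_le_of_le_one_left (abs_nonneg _) (hF _)).trans (hM₀ t M (hnM t ht))
  have h2 : |∑ j ∈ Finset.range (n % p), F ((M * p + j + a) % p) * z (M * p + j)| ≤ p := by
    refine (Finset.abs_sum_le_sum_abs _ _).trans ?_
    refine (Finset.sum_le_sum (g := fun _ => (1 : ℝ)) fun t _ => ?_).trans ?_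
    · rw [abs_mul]
      exact mul_le_one₀ (hF _) (abs_nonneg _) (hz _)
    · simp only [Finset.sum_const, Finset.card_range, nsmul_eq_mul, mul_one]
      exact_mod_cast hmod.le
  conv_lhs => rw [hsplit]
  rw [Finset.sum_range_add]
  refine (abs_add_le _ _).trans ((add_le_add h1 h2).trans ?_)
  nlinarith

variable {A : Type*} [Inhabited A] [Fintype A] {P : ℕ} {W : ℕ → List A} {Z : Bool → ℕ → ℝ}

theorem exists_level (hP : 2 ≤ P) (l : ℕ) (r : ℝ) {δ : ℝ} (hδ : 0 < δ) :
    ∃ k ≥ l, r / period P k ≤ δ := by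
  obtain ⟨K, hK⟩ := exists_nat_gt (r / δ)
  refine ⟨max l K, le_max_left _ _, ?_⟩
  have h1 : (K : ℝ) ≤ period P (max l K) := by
    exact_mod_cast (le_max_right l K).trans ((Nat.le_succ _).trans (succ_le_period hP _))
  have h2 := hK.trans_le h1
  rw [div_lt_iff₀ hδ] at h2
  have h3 : (0 : ℝ) < period P (max l K) := by exact_mod_cast period_pos hP _
  rw [div_le_iff₀ h3]
  linarith

/-- The phases of `x` and `x'` may differ, but changing the phase of a periodic sequence alters its
partial sums by at most one period. -/
theorem exists_abs_sum_ind_sub_le (hP : 4 * (60 + Fintype.card A) ≤ P) (hZ : ∀ c i, |Z c i| ≤ 1)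
    (hZ1 : ∀ i, Z true i = 1) (hW : Function.Surjective W) (w : List A) {δ : ℝ} (hδ : 0 < δ) :
    ∃ n₀, ∀ n ≥ n₀, ∀ x ∈ blockShift P W Z, ∀ x' ∈ blockShift P W Z,
      |∑ j ∈ Finset.range n, (ind w (fun t => x (j + t)) - ind w (fun t => x' (j + t)))| ≤
        δ * n := by
  have hP2 : 2 ≤ P := by omega
  obtain ⟨l, rfl⟩ := hW w
  obtain ⟨k, hlk, hk⟩ := exists_level hP2 l (5 * ((W l).length + 1)) (show 0 < δ / 4 by positivity)
  have hp := period_pos hP2 k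
  set F := freq (blocks P W Z k) (W l) (period P k) with hF
  obtain ⟨n₁, hn₁⟩ := exists_nat_gt (period P k * 4 / δ)
  have key : ∀ n ≥ max n₁ (period P (k + 1) ^ 2), ∀ x ∈ blockShift P W Z,
      |∑ j ∈ Finset.range n, ind (W l) (fun t => x (j + t)) -
        ∑ j ∈ Finset.range n, F (j % period P k)| ≤ δ / 2 * n := by
    intro n hn x hx
    obtain ⟨a, ha⟩ := exists_phase hP hZ hlk true hx ((le_max_right _ _).trans hn)
    simp only [hZ1, mul_one, ← hF, Finset.sum_sub_distrib] at ha
    have h1 := abs_sum_periodic_sub_le (F := F) (freq_nonneg _ _ _) (freq_le_one _ _ _) hp a n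
    have h2 : (period P k : ℝ) ≤ δ / 4 * n := by
      have : (n₁ : ℝ) ≤ n := by exact_mod_cast (le_max_left _ _).trans hn
      have h2 := hn₁.trans_le this
      rw [div_lt_iff₀ hδ] at h2
      linarith
    have h3 : 5 * ((W l).length + 1) / period P k * (n : ℝ) ≤ δ / 4 * n := by gcongr
    refine (abs_sub_le _ _ _).trans ((add_le_add (ha.trans h3) (h1.trans h2)).trans_eq ?_)
    ring
  refine ⟨max n₁ (period P (k + 1) ^ 2), fun n hn x hx x' hx' => ?_⟩
  rw [Finset.sum_sub_distrib]
  have h1 := abs_le.1 (key n hn x hx)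
  have h2 := abs_le.1 (key n hn x' hx')
  rw [abs_le]; constructor <;> linarith

theorem exists_abs_sum_ind_mul_le (hP : 4 * (60 + Fintype.card A) ≤ P) (hZ : ∀ c i, |Z c i| ≤ 1)
    (hap : ∀ p t : ℕ, 1 ≤ p → ∀ δ > 0, ∃ M₀, ∀ M ≥ M₀,
      |∑ s ∈ Finset.range M, Z false (s * p + t)| ≤ δ * M)
    (hW : Function.Surjective W) (w : List A) {δ : ℝ} (hδ : 0 < δ) :
    ∃ n₀, ∀ n ≥ n₀, ∀ x ∈ blockShift P W Z,
      |∑ j ∈ Finset.range n, ind w (fun t => x (j + t)) * Z false j| ≤ δ * n := by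
  have hP2 : 2 ≤ P := by omega
  obtain ⟨l, rfl⟩ := hW w
  obtain ⟨k, hlk, hk⟩ := exists_level hP2 l (5 * ((W l).length + 1)) (show 0 < δ / 2 by positivity)
  obtain ⟨n₁, hn₁⟩ := exists_abs_sum_periodic_mul_le (hZ false) hap (period_pos hP2 k)
    (show 0 < δ / 2 by positivity)
  refine ⟨max n₁ (period P (k + 1) ^ 2), fun n hn x hx => ?_⟩
  obtain ⟨a, ha⟩ := exists_phase hP hZ hlk false hx ((le_max_right _ _).trans hn)
  simp only [sub_mul, Finset.sum_sub_distrib] at ha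
  have h1 := hn₁ n ((le_max_left _ _).trans hn) (freq (blocks P W Z k) (W l) (period P k))
    (fun j => abs_le.2 ⟨by linarith [freq_nonneg (blocks P W Z k) (W l) (period P k) j],
      freq_le_one _ _ _ _⟩) a
  have h3 : 5 * ((W l).length + 1) / period P k * (n : ℝ) ≤ δ / 2 * n := by gcongr
  have h4 := abs_le.1 (ha.trans h3)
  have h5 := abs_le.1 h1
  rw [abs_le]; constructor <;> linarith

variable [TopologicalSpace A] [DiscreteTopology A]

/-- `blockShift` as a subshift. -/
def blockSubshift (P : ℕ) (W : ℕ → List A) (Z : Bool → ℕ → ℝ) : Subshift A ℕ where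
  carrier := blockShift P W Z
  isClosed := isClosed_blockShift
  mapsTo g _ hx := shift_mem_blockShift hx g

theorem isMinimalSystem_blockSubshift (hP : 4 * (60 + Fintype.card A) ≤ P)
    (hZ : ∀ c i, |Z c i| ≤ 1) (hZ1 : ∀ i, Z true i = 1) (hW : Function.Surjective W) :
    IsMinimalSystem (subshiftMap (blockSubshift P W Z)) := by
  refine ⟨(blockShift_nonempty hP hZ).to_subtype, fun C hC hCT => ?_⟩
  rw [or_iff_not_imp_left]
  intro hne
  obtain ⟨x', hx'⟩ := Set.nonempty_iff_ne_empty.2 hne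
  refine Set.eq_univ_of_forall fun x => ?_
  rw [← hC.closure_eq, mem_closure_iff_nhds]
  intro U hU
  obtain ⟨n, hn⟩ := exists_forall_agree_mem hU
  -- Length `n + 1` rather than `n` keeps the word nonempty.
  obtain ⟨m, -, b, hb, t, ht, hxb⟩ := x.2 (n + 1) 0
  have hocc : OccursIn (List.ofFn fun i : Fin (n + 1) => x.1 i) (period P m) b t :=
    ⟨by rwa [List.length_ofFn], fun i hi => by
      rw [List.getElem_ofFn]
      exact (hxb i (by rwa [List.length_ofFn] at hi)).symm⟩
  obtain ⟨i, hi⟩ := exists_startsWith hP hZ hZ1 hW hb hocc (by simp) x'.2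
  refine ⟨(subshiftMap _)^[i] x', hn _ fun j hj => ?_, hCT.iterate i hx'⟩
  rw [subshiftMap_iterate_val]
  have := hi j (by rw [List.length_ofFn]; omega)
  rwa [List.getElem_ofFn] at this

theorem isUniquelyErgodic_blockSubshift [MeasurableSpace (blockSubshift P W Z).carrier]
    [BorelSpace (blockSubshift P W Z).carrier] (hP : 4 * (60 + Fintype.card A) ≤ P)
    (hZ : ∀ c i, |Z c i| ≤ 1) (hZ1 : ∀ i, Z true i = 1) (hW : Function.Surjective W) :
    IsUniquelyErgodic (subshiftMap (blockSubshift P W Z)) := by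
  have : CompactSpace (blockSubshift P W Z).carrier :=
    isCompact_iff_compactSpace.1 (blockSubshift P W Z).isClosed.isCompact
  have : Nonempty (blockSubshift P W Z).carrier := (blockShift_nonempty hP hZ).to_subtype
  refine isUniquelyErgodic_of_birkhoff_sums (continuous_subshiftMap _) fun f δ hδ => ?_
  obtain ⟨n₀, hn₀⟩ := birkhoff_estimate_of_words (z := fun _ => 1) (z' := fun _ => 1)
    (by simp) (by simp) (fun w δ hδ => by
      obtain ⟨n₀, hn₀⟩ := exists_abs_sum_ind_sub_le hP hZ hZ1 hW w hδ
      exact ⟨n₀, fun n hn x x' => by simpa using hn₀ n hn x.1 x.2 x'.1 x'.2⟩) f δ hδ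
  refine ⟨n₀ + 1, by omega, fun x x' => ?_⟩
  rw [← Finset.sum_sub_distrib]
  simpa using hn₀ (n₀ + 1) (by omega) x x'

theorem uniformlyUncorrelated_blockSubshift (hP : 4 * (60 + Fintype.card A) ≤ P)
    (hZ : ∀ c i, |Z c i| ≤ 1) (hap : ∀ p t : ℕ, 1 ≤ p → ∀ δ > 0, ∃ M₀, ∀ M ≥ M₀,
      |∑ s ∈ Finset.range M, Z false (s * p + t)| ≤ δ * M) (hW : Function.Surjective W)
    {y : ℕ → ℝ} {C : ℝ} (hC : 0 < C) (hy : ∀ j, y (j + 1) = C * Z false j) :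
    UniformlyUncorrelated (subshiftMap (blockSubshift P W Z)) y := by
  intro f
  rw [Metric.tendstoUniformly_iff]
  intro ε hε
  obtain ⟨n₀, hn₀⟩ := birkhoff_estimate_of_words (z := Z false) (z' := fun _ => 0)
    (hZ false) (by simp) (fun w δ hδ => by
      obtain ⟨n₀, hn₀⟩ := exists_abs_sum_ind_mul_le hP hZ hap hW w hδ
      exact ⟨n₀, fun n hn x x' => by simpa using hn₀ n hn x.1 x.2⟩) f (ε / (2 * C))
        (by positivity)
  filter_upwards [eventually_ge_atTop (max n₀ 1)] with n hn x
  have hn1 : (0 : ℝ) < n := by exact_mod_cast (le_max_right _ _).trans hn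
  set T := subshiftMap (blockSubshift P W Z)
  -- The average starts at `i = 1`, so the sum from `0` is taken along the orbit of `T x`, matching
  -- the weight `y (j + 1)`.
  have h1 := hn₀ n ((le_max_left _ _).trans hn) (T x) (T x)
  have h2 : ∑ i ∈ Finset.Icc 1 n, f (T^[i] x) * y i =
      C * ∑ j ∈ Finset.range n, (f (T^[j] (T x)) * Z false j - f (T^[j] (T x)) * 0) := by
    rw [← Finset.Ico_add_one_right_eq_Icc, Finset.sum_Ico_eq_sum_range, Nat.add_sub_cancel, Finset.mul_sum]
    refine Finset.sum_congr rfl fun j _ => ?_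
    rw [add_comm 1 j, hy, ← Function.iterate_succ_apply]
    ring
  rw [dist_comm, dist_zero_right, h2, Real.norm_eq_abs, abs_mul, abs_mul, abs_of_pos hC,
    abs_of_pos (by positivity)]
  calc 1 / (n : ℝ) * (C * _) ≤ 1 / (n : ℝ) * (C * (ε / (2 * C) * n)) := by gcongr
    _ = ε / 2 := by field_simp
    _ < ε := by linarith

end BlockShift

/-! ### Topological entropy through words. -/

section Entropy

open Dynamics ExpGrowth Uniformity

variable {A : Type*} [UniformSpace A] [DiscreteUniformity A] {C : Set (ℕ → A)} {T : C → C}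

theorem setOf_apply_eq_mem_uniformity (i : ℕ) : {q : C × C | q.1.1 i = q.2.1 i} ∈ 𝓤 C := by
  have h : UniformContinuous fun x : C => x.1 i :=
    (Pi.uniformContinuous_proj (fun _ : ℕ => A) i).comp uniformContinuous_subtype_val
  have := h (DiscreteUniformity.relId_mem_uniformity A)
  exact this

theorem exists_forall_agree_mem_of_mem_uniformity {U : Set (C × C)} (hU : U ∈ 𝓤 C) :
    ∃ r, ∀ x x' : C, (∀ i < r, x.1 i = x'.1 i) → (x, x') ∈ U := by
  have hle : (⨅ r : ℕ, 𝓟 {q : C × C | ∀ i < r, q.1.1 i = q.2.1 i}) ≤ 𝓤 C := by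
    rw [uniformity_subtype, Pi.uniformity, comap_iInf]
    refine le_iInf fun i => (iInf_le _ (i + 1)).trans ?_
    rw [DiscreteUniformity.eq_principal_setRelId A, comap_principal, comap_principal,
      principal_mono]
    intro q hq
    exact hq i (by omega)
  have hmem := hle hU
  rw [mem_iInf_of_directed] at hmem
  · obtain ⟨r, hr⟩ := hmem
    exact ⟨r, fun x x' h => hr h⟩
  · intro a b
    refine ⟨max a b, ?_, ?_⟩
    · exact principal_mono.2 fun q hq i hi => hq i (hi.trans_le (le_max_left _ _))
    · exact principal_mono.2 fun q hq i hi => hq i (hi.trans_le (le_max_right _ _))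

/-- An entourage is determined by finitely many coordinates, say `r`, so one point per word of
length `r + n` gives a cover; the factor `|A| ^ r` does not affect the growth rate. -/
theorem coverEntropy_le_log_card [Fintype A]
    (hT : ∀ i x, (T^[i] x).1 = fun t => x.1 (i + t)) :
    coverEntropy T Set.univ ≤ ENNReal.log (Fintype.card A) := by
  classical
  refine iSup₂_le fun U hU => ?_
  obtain ⟨r, hr⟩ := exists_forall_agree_mem_of_mem_uniformity hU
  rw [coverEntropyEntourage, ← expGrowthSup_pow]
  refine expGrowthSup_le_of_eventually_le (b := (Fintype.card A : ENNReal) ^ r)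
    (ENNReal.pow_ne_top (ENNReal.natCast_ne_top _)) (Eventually.of_forall fun n => ?_)
  let W : Type _ := {u : Fin (r + n) → A // ∃ x : C, ∀ i : Fin (r + n), x.1 i = u i}
  let s : Finset C := Finset.univ.image fun u : W => u.2.choose
  have hs : IsDynCoverOf T Set.univ U n (s : Set C) := by
    intro x _
    let u : W := ⟨fun i => x.1 i, x, fun _ => rfl⟩
    refine ⟨u.2.choose, Finset.mem_coe.2 (Finset.mem_image_of_mem _ (Finset.mem_univ u)), mem_dynEntourage.2 fun k hk => ?_⟩
    refine hr _ _ fun i hi => ?_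
    rw [hT, hT]
    exact (u.2.choose_spec ⟨k + i, by omega⟩).symm
  have hcard : s.card ≤ Fintype.card A ^ (r + n) := by
    refine Finset.card_image_le.trans ?_
    rw [Finset.card_univ]
    refine (Fintype.card_subtype_le _).trans ?_
    simp
  have h1 := hs.coverMincard_le_card.trans (Nat.cast_le.2 hcard)
  rw [← pow_add]
  calc ((coverMincard T Set.univ U n : ℕ∞) : ENNReal)
      ≤ (((Fintype.card A ^ (r + n) : ℕ) : ℕ∞) : ENNReal) := by exact_mod_cast h1
    _ = _ := by simp

/-- For the entourage of equality at coordinate `0`, points with distinct words of length `n` form a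
dynamical net. The growth rate is an upper limit, so arbitrarily large `n` suffice. -/
theorem le_coverEntropy_of_words (hT : ∀ i x, (T^[i] x).1 = fun t => x.1 (i + t)) {h : ℝ}
    (hs : ∀ k : ℕ, ∃ n ≥ k, ∃ s : Finset C,
      (∀ x ∈ s, ∀ x' ∈ s, (∀ i < n, x.1 i = x'.1 i) → x = x') ∧ Real.exp (h * n) ≤ s.card) :
    (h : EReal) ≤ coverEntropy T Set.univ := by
  refine le_trans ?_ (netEntropyEntourage_le_coverEntropy T Set.univ
    (setOf_apply_eq_mem_uniformity 0))
  refine Frequently.le_expGrowthSup (frequently_atTop.2 fun k => ?_)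
  obtain ⟨n, hn, s, hinj, hcard⟩ := hs k
  refine ⟨n, hn, ?_⟩
  have hnet : IsDynNetIn T Set.univ {q : C × C | q.1.1 0 = q.2.1 0} n (s : Set C) := by
    refine ⟨Set.subset_univ _, fun x hx x' hx' hne => ?_⟩
    rw [Function.onFun, Set.disjoint_left]
    intro z hz hz'
    refine hne (hinj x hx x' hx' fun i hi => ?_)
    have h1 := mem_dynEntourage.1 hz i hi
    have h2 := mem_dynEntourage.1 hz' i hi
    simp only [Set.mem_ofPred_eq, hT, add_zero] at h1 h2
    rw [h1, h2]
  have h1 := hnet.card_le_netMaxcard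
  calc EReal.exp (h * n) = ENNReal.ofReal (Real.exp (h * n)) := by
        rw [← EReal.exp_coe]; push_cast; rfl
    _ ≤ ENNReal.ofReal (s.card : ℝ) := ENNReal.ofReal_le_ofReal hcard
    _ = (((s.card : ℕ∞)) : ENNReal) := by simp
    _ ≤ _ := by exact_mod_cast h1

end Entropy

/-! ### Growth of the number of blocks. -/

namespace BlockShift

variable {A : Type*} [Inhabited A] [Fintype A] {P : ℕ} {W : ℕ → List A} {Z : Bool → ℕ → ℝ}

/-- Each level keeps at least half of the concatenations. The constant `2` is multiplied by the
number of sub-blocks, which pays for that factor; at level `0` the bound is an equality. -/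
theorem exp_le_card_blocks (hP : 4 * (60 + Fintype.card A) ≤ P) (hZ : ∀ c i, |Z c i| ≤ 1)
    (k : ℕ) : Real.exp ((Real.log (Fintype.card A) - 2 / P) * period P k + 2) ≤
      (blocks P W Z k).card := by
  have hP2 : 2 ≤ P := by omega
  have hP0 : (0 : ℝ) < P := by exact_mod_cast (by omega : 0 < P)
  have hA0 : (0 : ℝ) < Fintype.card A := by exact_mod_cast (Fintype.card_pos : 0 < Fintype.card A)
  induction k with
  | zero =>
    have e : (Real.log (Fintype.card A) - 2 / P) * period P 0 + 2 =
        P * Real.log (Fintype.card A) := by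
      rw [period_zero]; field_simp; ring
    rw [e, card_blocks_zero, Real.exp_nat_mul, Real.exp_log hA0]
    push_cast
    exact le_rfl
  | succ k ih =>
    have h1 := le_card_blocks_succ hP hZ k (blocks_nonempty (W := W) hP hZ k)
    refine le_trans ?_ h1
    have h2 := defect_le_half (A := A) hP2 k
    have hp1 : (2 : ℝ) ≤ period P k := by exact_mod_cast hP2.trans (le_period P k)
    have hq : (2 : ℝ) ≤ (period P k : ℝ) ^ 4 := by
      calc (2 : ℝ) ≤ period P k := hp1
        _ ≤ (period P k : ℝ) ^ 4 := le_self_pow₀ (by linarith) (by norm_num)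
    have hexp : Real.exp (-1) ≤ 1 / 2 := by
      rw [Real.exp_neg, ← one_div]
      exact one_div_le_one_div_of_le (by norm_num) (by linarith [Real.add_one_le_exp (1 : ℝ)])
    calc Real.exp ((Real.log (Fintype.card A) - 2 / P) * period P (k + 1) + 2)
        ≤ Real.exp (-1 + (period P k ^ 4 : ℕ) *
            ((Real.log (Fintype.card A) - 2 / P) * period P k + 2)) := by
          refine Real.exp_le_exp.2 ?_
          rw [period_succ]
          push_cast
          nlinarith
      _ = Real.exp (-1) *
          Real.exp ((Real.log (Fintype.card A) - 2 / P) * period P k + 2) ^ (period P k ^ 4) := by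
          rw [Real.exp_add, Real.exp_nat_mul]
      _ ≤ (1 - defect A P k) * ((blocks P W Z k).card : ℝ) ^ (period P k ^ 4) := by
          have h3 : Real.exp (-1) ≤ 1 - defect A P k := by linarith
          have h4 : 0 ≤ 1 - defect A P k := by linarith
          gcongr

theorem exists_mem_blockShift_agree (hP : 4 * (60 + Fintype.card A) ≤ P)
    (hZ : ∀ c i, |Z c i| ≤ 1) (hZ1 : ∀ i, Z true i = 1) (hW : Function.Surjective W)
    [TopologicalSpace A] [DiscreteTopology A] {k : ℕ} {b : ℕ → A} (hb : b ∈ blocks P W Z k) :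
    ∃ x ∈ blockShift P W Z, ∀ i < period P k, x i = b i := by
  have hP2 : 2 ≤ P := by omega
  obtain ⟨x, hx⟩ := blockShift_nonempty (W := W) hP hZ
  have hocc : OccursIn (List.ofFn fun i : Fin (period P k) => b i) (period P k) b 0 :=
    ⟨by rw [List.length_ofFn, zero_add], fun i hi => by rw [List.getElem_ofFn]; simp⟩
  obtain ⟨i, hi⟩ := exists_startsWith hP hZ hZ1 hW hb hocc (by
    rw [← List.length_pos_iff, List.length_ofFn]; exact period_pos hP2 k) hx
  refine ⟨_, shift_mem_blockShift hx i, fun j hj => ?_⟩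
  have := hi j (by rwa [List.length_ofFn])
  rwa [List.getElem_ofFn] at this

theorem exists_finset_words (hP : 4 * (60 + Fintype.card A) ≤ P)
    (hZ : ∀ c i, |Z c i| ≤ 1) (hZ1 : ∀ i, Z true i = 1) (hW : Function.Surjective W)
    [TopologicalSpace A] [DiscreteTopology A] (k : ℕ) :
    ∃ s : Finset (blockShift P W Z),
      (∀ x ∈ s, ∀ x' ∈ s, (∀ i < period P k, x.1 i = x'.1 i) → x = x') ∧
      s.card = (blocks P W Z k).card := by
  classical
  have hP2 : 2 ≤ P := by omega
  choose g hg hgb using fun b : blocks P W Z k => exists_mem_blockShift_agree hP hZ hZ1 hW b.2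
  have hinj : ∀ b b' : blocks P W Z k, (∀ i < period P k, g b i = g b' i) → b = b' := by
    intro b b' h
    refine Subtype.ext (funext fun i => ?_)
    by_cases hi : i < period P k
    · rw [← hgb b i hi, ← hgb b' i hi, h i hi]
    · rw [eq_default_of_mem_blocks hP2 b.2 (not_lt.1 hi),
        eq_default_of_mem_blocks hP2 b'.2 (not_lt.1 hi)]
  refine ⟨Finset.univ.image fun b => ⟨g b, hg b⟩, ?_, ?_⟩
  · intro x hx x' hx' h
    obtain ⟨b, -, rfl⟩ := Finset.mem_image.1 hx
    obtain ⟨b', -, rfl⟩ := Finset.mem_image.1 hx'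
    rw [hinj b b' h]
  · rw [Finset.card_image_of_injective]
    · simp
    · intro b b' h
      exact hinj b b' fun i _ => congrFun (congrArg Subtype.val h) i

end BlockShift

/-! ### Entropy bounds for the subshift, and the conclusion. -/

theorem subshiftEntropy_le_log {N : ℕ} (S : Subshift (Fin N) ℕ) (hN : 1 ≤ N) :
    subshiftEntropy S ≤ (Real.log N : ℝ) := by
  let : UniformSpace (Fin N) := ⊥
  have := coverEntropy_le_log_card (T := subshiftMap S) (subshiftMap_iterate_val S)
  refine this.trans_eq ?_
  have hN0 : (0 : ℝ) < N := by exact_mod_cast hN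
  rw [Fintype.card_fin, ← ENNReal.ofReal_natCast, ENNReal.log_ofReal, if_neg (not_le.2 hN0)]

open BlockShift in
theorem le_subshiftEntropy_blockSubshift {N : ℕ} [NeZero N] {P : ℕ} {W : ℕ → List (Fin N)}
    {Z : Bool → ℕ → ℝ} (hP : 4 * (60 + N) ≤ P)
    (hZ : ∀ c i, |Z c i| ≤ 1) (hZ1 : ∀ i, Z true i = 1) (hW : Function.Surjective W) :
    ((Real.log N - 2 / P : ℝ) : EReal) ≤ subshiftEntropy (blockSubshift P W Z) := by
  have hP' : 4 * (60 + Fintype.card (Fin N)) ≤ P := by rwa [Fintype.card_fin]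
  let : UniformSpace (Fin N) := ⊥
  refine le_coverEntropy_of_words (T := subshiftMap (blockSubshift P W Z))
    (subshiftMap_iterate_val _) fun k => ?_
  obtain ⟨s, hs, hcard⟩ := exists_finset_words hP' hZ hZ1 hW k
  refine ⟨period P k, (Nat.le_succ k).trans (succ_le_period (by omega) k), s, hs, ?_⟩
  refine le_trans (Real.exp_le_exp.2 ?_)
    ((exp_le_card_blocks hP' hZ k).trans_eq (congrArg Nat.cast hcard.symm))
  rw [Fintype.card_fin]
  linarith

theorem IsAperiodicSeq.exists_abs_sum_le {y : ℕ → ℝ} (hy : IsAperiodicSeq y) {p : ℕ} (hp : 1 ≤ p)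
    (t : ℕ) {δ : ℝ} (hδ : 0 < δ) :
    ∃ M₀, ∀ M ≥ M₀, |∑ s ∈ Finset.range M, y (s * p + t + 1)| ≤ δ * M := by
  obtain ⟨⟨C, hC⟩, hap⟩ := hy
  have h1 := (Metric.tendsto_atTop.1 (hap p (t + 1) hp)) (δ / 2) (by positivity)
  obtain ⟨M₁, hM₁⟩ := h1
  obtain ⟨M₂, hM₂⟩ := exists_nat_gt (4 * C / δ)
  refine ⟨max M₁ (max M₂ 1), fun M hM => ?_⟩
  have hM1 : (0 : ℝ) < M := by
    exact_mod_cast ((le_max_right _ _).trans (le_max_right _ _)).trans hM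
  have h2 := hM₁ M ((le_max_left _ _).trans hM)
  rw [Real.dist_eq, sub_zero, abs_mul, abs_of_pos (by positivity), one_div,
    inv_mul_lt_iff₀ hM1] at h2
  have h3 : 4 * C ≤ δ * M := by
    have : (M₂ : ℝ) ≤ M := by
      exact_mod_cast ((le_max_left _ _).trans (le_max_right _ _)).trans hM
    have h4 := hM₂.trans_le this
    rw [div_lt_iff₀ hδ] at h4
    linarith
  -- Passing from `s = 0, …, M - 1` to `i = 1, …, M` exchanges two end terms, at most `2 * C ≤ δ * M
  -- / 2` together.
  have h5 : ∑ s ∈ Finset.range M, y (s * p + t + 1) + y (M * p + t + 1) =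
      y (t + 1) + ∑ i ∈ Finset.Icc 1 M, y (i * p + (t + 1)) := by
    rw [← Finset.sum_range_succ (fun s => y (s * p + t + 1)), Finset.sum_range_succ',
      ← Finset.Ico_add_one_right_eq_Icc, Finset.sum_Ico_eq_sum_range, Nat.add_sub_cancel,
      add_comm, zero_mul, zero_add]
    congr 1
    refine Finset.sum_congr rfl fun s _ => ?_
    rw [add_comm 1 s, add_assoc]
  have h6 := abs_le.1 (hC (M * p + t + 1) (by omega))
  have h7 := abs_le.1 (hC (t + 1) (by omega))
  have h8 := abs_lt.1 h2
  rw [abs_le]; constructor <;> linarith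

open BlockShift in
theorem theorem2 (y : ℕ → ℝ) (hy : IsAperiodicSeq y) (N : ℕ) (hN : 2 ≤ N)
    (ε : ℝ) (hε : 0 < ε) :
    ∃ S : Subshift (Fin N) ℕ,
      IsStrictlyErgodic (subshiftMap S) ∧
      ((Real.log N - ε : ℝ) : EReal) < subshiftEntropy S ∧
      subshiftEntropy S < ((Real.log N + ε : ℝ) : EReal) ∧
      UniformlyUncorrelated (subshiftMap S) y := by
  have : NeZero N := ⟨by omega⟩
  obtain ⟨C₀, hC₀⟩ := hy.1
  set C : ℝ := |C₀| + 1 with hCdef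
  have hC : 0 < C := by positivity
  let Z : Bool → ℕ → ℝ := fun c j => if c then 1 else y (j + 1) / C
  have hZ : ∀ c i, |Z c i| ≤ 1 := by
    intro c i
    cases c
    · have h1 : |y (i + 1)| ≤ C := (hC₀ _ (by omega)).trans (by linarith [le_abs_self C₀])
      simpa [Z, abs_div, abs_of_pos hC, div_le_one hC] using h1
    · simp [Z]
  have hZ1 : ∀ i, Z true i = 1 := fun i => by simp [Z]
  have hap : ∀ p t : ℕ, 1 ≤ p → ∀ δ > 0, ∃ M₀, ∀ M ≥ M₀,
      |∑ s ∈ Finset.range M, Z false (s * p + t)| ≤ δ * M := by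
    intro p t hp δ hδ
    obtain ⟨M₀, hM₀⟩ := hy.exists_abs_sum_le hp t (mul_pos hδ hC)
    refine ⟨M₀, fun M hM => ?_⟩
    have h1 := hM₀ M hM
    simp only [Z, Bool.false_eq_true, if_false]
    rw [← Finset.sum_div, abs_div, abs_of_pos hC, div_le_iff₀ hC]
    linarith
  obtain ⟨W, hW⟩ := exists_surjective_nat (List (Fin N))
  obtain ⟨P₀, hP₀⟩ := exists_nat_gt (2 / ε)
  set P := max P₀ (4 * (60 + N)) with hPdef
  have hP : 4 * (60 + N) ≤ P := le_max_right _ _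
  have hP' : 4 * (60 + Fintype.card (Fin N)) ≤ P := by rwa [Fintype.card_fin]
  refine ⟨blockSubshift P W Z, ⟨isMinimalSystem_blockSubshift hP' hZ hZ1 hW,
    isUniquelyErgodic_blockSubshift hP' hZ hZ1 hW⟩, ?_, ?_,
    uniformlyUncorrelated_blockSubshift hP' hZ hap hW hC fun j => ?_⟩
  · refine lt_of_lt_of_le (EReal.coe_lt_coe_iff.2 ?_)
      (le_subshiftEntropy_blockSubshift hP hZ hZ1 hW)
    have hP0 : (0 : ℝ) < P := by exact_mod_cast (by omega : 0 < P)
    have h1 : 2 / ε < P := hP₀.trans_le (by exact_mod_cast le_max_left _ _)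
    have h2 : 2 / (P : ℝ) < ε := by
      rw [div_lt_iff₀ hε] at h1
      rw [div_lt_iff₀ hP0]
      linarith
    linarith
  · refine (subshiftEntropy_le_log _ (by omega)).trans_lt (EReal.coe_lt_coe_iff.2 ?_)
    linarith
  · simp only [Z, Bool.false_eq_true, if_false]
    field_simp
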